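/- Let $n\ge 3$, let $C_n=\mathbb Z/n\mathbb Z$, and let $C_2\wr C_n=\{(\omega,k):\omega\in C_2^n,\ k\in C_n\}$ with product $(\theta,k)(\omega,h)=(\theta+k\omega,k+h)$, where $C_n$ acts on functions on $C_n$ by $(kf)(j)=f(j-k)$. Let $L(C_2\wr C_n)$ be the space of complex functions on $C_2\wr C_n$, with the left regular representation and the scalar product $\langle F,F'\rangle=\sum F\overline{F'}$. Regard $\theta\in C_2^n$ as a $0/1$ labelling of the edges of the discrete circle, $\theta(k)$ being the label of the edge $\{k,k+1\}$. Let $\mathcal M$ be the Markov operator on $L(C_2\wr C_n)$ of the simple random walk on the graph in which $(\omega,x)$ and $(\omega',y)$ are adjacent when $x\sim y$ on the circle and $\omega,\omega'$ agree on every edge other than $\{x,y\}$ (the edge-lamplighter operator). Fix $\theta\in C_2^n$. Let $t=t(\theta)$ be its period (the smallest $t\ge1$ with $\theta(k+t)=\theta(k)$ for all $k$), let $m=n/t$, and let $0\le r\le m-1$. Put $\chi_\theta(\omega)=(-1)^{\sum_k\theta(k)\omega(k)}$, $e_r(h)=\exp(2\pi i hr/n)$, and let $\tilde\chi_\theta\otimes(e_r|_{\langle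 t\rangle})^\#$ be the character $(\omega,h)\mapsto\chi_\theta(\omega)e_r(h)$ of the subgroup $C_2\wr\langle t\rangle=\{(\omega,h):h\in\langle t\rangle\}$. For $0\le s\le t-1$ let $f_{r,s}\in L(C_n)$ be given by $f_{r,s}(k)=e_{m-r}(k-s)$ if $k-s\in\langle t\rangle$ and $f_{r,s}(k)=0$ otherwise. Let $$(M_\theta f)(x)=\tfrac12\sum_{y\sim x,\ \theta(\{x,y\})=0}f(y),\qquad f\in L(C_n).$$ (1) There is an orthogonal basis $\phi_{r,0},\dots,\phi_{r,t-1}$ of $\langle f_{r,0},\dots,f_{r,t-1}\rangle$ consisting of eigenvectors of $M_\theta$. (2) Let $\phi_{r,0},\dots,\phi_{r,t-1}$ be any such basis, with $M_\theta\phi_{r,j}=\mu_j\phi_{r,j}$. For each $j$, the group $C_2\wr\langle t\rangle$ acts on the line spanned by $\chi_\theta\otimes\phi_{r,j}$ by the character $\tilde\chi_\theta\otimes(e_r|_{\langle t\rangle})^\#$. The subspace $$W_j=\mathrm{Ind}_{C_2\wr\langle t\rangle}^{C_2\wr C_n}\langle\tilde\chi_\theta\otimes(\phi_{r,j})^\#\rangle:=\Big\langle\chi_{s\theta}\otimes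 s\phi_{r,j}:\ 0\le s\le t-1\Big\rangle\subseteq L(C_2\wr C_n)$$ is $C_2\wr C_n$-invariant and irreducible, and is equivalent to $\mathrm{Ind}_{C_2\wr\langle t\rangle}^{C_2\wr C_n}[\tilde\chi_\theta\otimes(e_r|_{\langle t\rangle})^\#]$. The $\mathrm{Ind}_{C_2\wr\langle t\rangle}^{C_2\wr C_n}[\tilde\chi_\theta\otimes(e_r|_{\langle t\rangle})^\#]$-isotypic component of $L(C_2\wr C_n)$ is the orthogonal direct sum $\bigoplus_{j=0}^{t-1}W_j$, and $\mathcal M F=\mu_jF$ for every $F\in W_j$. (3) The eigenvalues $\mu_0,\dots,\mu_{t-1}$, counted with multiplicity, are as follows. If $\theta=0$ (so that $t=1$), then $\mu_0=\cos\frac{2\pi r}{n}$. If $\theta\ne0$, they are the numbers $\cos\frac{h\pi}{l_a+1}$, $1\le h\le l_a$, where $a$ runs over those of $0,1,\dots,t-1$ with $\theta(a-1)=1$, and $l_a\ge1$ is the least positive integer with $\theta(a+l_a-1)=1$, that is, the number of vertices of the path starting at $a$ in the circle with all edges labelled $1$ deleted. -/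

import Mathlib

noncomputable section

namespace CircleLamp

open scoped Classical ComplexConjugate

/-! ### Generalities: scalar products, Markov operators, isotypic components -/

/-- The scalar product of `L(X)`, the complex functions on a finite set `X`. -/
def scalarProd {X : Type*} [Fintype X] (f g : X → ℂ) : ℂ := ∑ x, f x * conj (g x)

/-- The Markov operator of the simple random walk on a finite graph. -/
def markovOp {V : Type*} [Fintype V] (G : SimpleGraph V) : (V → ℂ) →ₗ[ℂ] (V → ℂ) where
  toFun f x := (1 / (G.degree x : ℂ)) * ∑ y, if G.Adj x y then f y else 0
  map_add' f g := by
    funext x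
    simp only [Pi.add_apply, ← mul_add, ← Finset.sum_add_distrib]
    congr 1
    refine Finset.sum_congr rfl fun y _ => ?_
    split_ifs <;> simp
  map_smul' c f := by
    funext x
    simp only [Pi.smul_apply, smul_eq_mul, RingHom.id_apply, Finset.mul_sum]
    refine Finset.sum_congr rfl fun y _ => ?_
    split_ifs <;> ring

/-- The left regular representation of `W` on `L(W)`: `(g f)(x) = f (g⁻¹ x)`. -/
def regRep (W : Type*) [Group W] : Representation ℂ W (W → ℂ) where
  toFun g :=
    { toFun := fun f x => f (g⁻¹ * x)
      map_add' := fun _ _ => rfl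
      map_smul' := fun _ _ => rfl }
  map_one' := by ext f x; simp
  map_mul' g h := by ext f x; simp [mul_assoc]

/-- The isotypic component of type `σ` in `ρ`: the sum of all the subrepresentations
of `ρ` that are equivalent to `σ`. -/
def isotypic {W V V' : Type*} [Group W] [AddCommGroup V] [Module ℂ V] [AddCommGroup V']
    [Module ℂ V'] (ρ : Representation ℂ W V) (σ : Representation ℂ W V') : Submodule ℂ V :=
  ⨆ (U : Subrepresentation ρ) (_ : Nonempty (U.toRepresentation.Equiv σ)), U.toSubmodule

/-- The one-dimensional representation on `ℂ` given by a multiplicative character. -/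
def charRep {H : Type*} [Group H] (ψ : H →* ℂ) : Representation ℂ H ℂ :=
  (Algebra.lmul ℂ ℂ : ℂ →* Module.End ℂ ℂ).comp ψ

/-! ### The group `C₂ ≀ Cₙ` and the lamplighter walk -/

/-- The wreath product `C₂ ≀ Cₙ`. -/
abbrev Wreath (n : ℕ) : Type := Multiplicative (ZMod 2) ≀ᵣ Multiplicative (ZMod n)

variable {n : ℕ}

/-- The lamp configuration `ω` of `(ω, x)`. -/
def lamps (g : Wreath n) (k : ZMod n) : ZMod 2 := (g.left (Multiplicative.ofAdd k)).toAdd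

/-- The position `x` of `(ω, x)`. -/
def pos (g : Wreath n) : ZMod n := g.right.toAdd

/-- The action of `Cₙ` on functions on `Cₙ`: `(s f)(k) = f (k - s)`. -/
def translate {A : Type*} (s : ZMod n) (f : ZMod n → A) : ZMod n → A := fun k => f (k - s)

theorem lamps_mul (g h : Wreath n) :
    lamps (g * h) = lamps g + translate (pos g) (lamps h) := by
  funext k
  simp only [lamps, translate, pos, RegularWreathProduct.mul_left, Pi.mul_apply, toAdd_mul,
    Pi.add_apply]
  congr 3
  rw [sub_eq_neg_add]
  rfl

theorem pos_mul (g h : Wreath n) : pos (g * h) = pos g + pos h := rfl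

theorem lamps_one : lamps (1 : Wreath n) = 0 := rfl

theorem pos_one : pos (1 : Wreath n) = 0 := rfl

/-- The discrete circle. -/
def circle (n : ℕ) : SimpleGraph (ZMod n) := SimpleGraph.circulantGraph {1}

/-- The edge `{k, k + 1}` of the circle; it carries the lamp with index `k`. -/
def edgeOf (k : ZMod n) : Sym2 (ZMod n) := s(k, k + 1)

/-- The graph of the edge lamplighter: `(ω, x)` and `(ω', y)` are adjacent when `x ∼ y` and `ω`,
`ω'` agree at every lamp whose edge is not `{x, y}`. -/
def lampGraph (n : ℕ) : SimpleGraph (Wreath n) where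
  Adj g h := (circle n).Adj (pos g) (pos h) ∧
    ∀ k, edgeOf k ≠ s(pos g, pos h) → lamps g k = lamps h k
  symm := ⟨fun g h H => ⟨H.1.symm, fun k hk => (H.2 k (by rwa [Sym2.eq_swap])).symm⟩⟩
  loopless := ⟨fun _ H => H.1.ne rfl⟩

section

variable [NeZero n]

instance : Fintype (Wreath n) :=
  Fintype.ofEquiv _ (RegularWreathProduct.equivProd _ _).symm

/-- The Markov operator `𝓜` of the edge lamplighter walk on the circle, on `L(C₂ ≀ Cₙ)`. -/
def lampOp (n : ℕ) [NeZero n] : (Wreath n → ℂ) →ₗ[ℂ] (Wreath n → ℂ) := markovOp (lampGraph n)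

/-- The operator `M_θ` on `L(Cₙ)`: only the neighbours `y` of `x` with `θ({x, y}) = 0`
contribute, with weight `1 / deg x` where `deg x` is the degree in the full circle. -/
def thetaOp (θ : ZMod n → ZMod 2) (f : ZMod n → ℂ) (x : ZMod n) : ℂ :=
  (1 / ((circle n).degree x : ℂ)) *
    ∑ y, if (circle n).Adj x y ∧ (∀ k, edgeOf k = s(x, y) → θ k = 0) then f y else 0

end

/-! ### Characters -/

/-- The character `χ_θ(ω) = (-1)^{θ·ω}` of `C₂ⁿ`. -/
def chi [NeZero n] (θ ω : ZMod n → ZMod 2) : ℂ := (-1) ^ (∑ k, θ k * ω k).val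

/-- The character `e_r(h) = exp(2πi h r / n)` of `Cₙ`. -/
def e [NeZero n] (r : ℕ) (h : ZMod n) : ℂ := ZMod.stdAddChar ((r : ZMod n) * h)

/-- The function `χ ⊗ f` on `C₂ ≀ Cₙ`: `(χ ⊗ f)(ω, x) = χ(ω) f(x)`. -/
def tens (χ : (ZMod n → ZMod 2) → ℂ) (f : ZMod n → ℂ) (g : Wreath n) : ℂ :=
  χ (lamps g) * f (pos g)

/-- The period `t(θ)`: the smallest positive `t` with `θ(k + t) = θ(k)` for all `k`. -/
def period (θ : ZMod n → ZMod 2) : ℕ := sInf {t : ℕ | 0 < t ∧ ∀ k : ZMod n, θ (k + t) = θ k}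

/-- The subgroup `⟨t(θ)⟩` of `Cₙ`. -/
def perSub (θ : ZMod n → ZMod 2) : AddSubgroup (ZMod n) :=
  AddSubgroup.zmultiples (period θ : ZMod n)

/-- The subgroup `C₂ ≀ ⟨t(θ)⟩` of `C₂ ≀ Cₙ`. -/
def inertia (θ : ZMod n → ZMod 2) : Subgroup (Wreath n) where
  carrier := {g | pos g ∈ perSub θ}
  mul_mem' ha hb := by
    simp only [Set.mem_ofPred_eq, pos_mul] at *
    exact add_mem ha hb
  one_mem' := by simp only [Set.mem_ofPred_eq, pos_one]; exact zero_mem _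
  inv_mem' {g} hg := by
    have : pos g⁻¹ = - pos g := rfl
    simp only [Set.mem_ofPred_eq, this] at *
    exact neg_mem hg

section

variable [NeZero n]

theorem period_spec (θ : ZMod n → ZMod 2) :
    0 < period θ ∧ ∀ k : ZMod n, θ (k + (period θ : ZMod n)) = θ k :=
  Nat.sInf_mem (s := {t : ℕ | 0 < t ∧ ∀ k : ZMod n, θ (k + t) = θ k})
    ⟨n, Nat.pos_of_ne_zero (NeZero.ne n), fun k => by simp⟩

theorem add_mem_perSub (θ : ZMod n → ZMod 2) {h : ZMod n} (hh : h ∈ perSub θ) (k : ZMod n) :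
    θ (k + h) = θ k := by
  obtain ⟨z, rfl⟩ := AddSubgroup.mem_zmultiples_iff.mp hh
  have hp := (period_spec θ).2
  induction z using Int.induction_on generalizing k with
  | zero => simp
  | succ i ih =>
    rw [add_zsmul, one_zsmul, ← add_assoc, hp, ih k (AddSubgroup.zsmul_mem_zmultiples _ _)]
  | pred i ih =>
    rw [← ih k (AddSubgroup.zsmul_mem_zmultiples _ _), ← hp (k + _), sub_zsmul, one_zsmul]
    congr 1
    ring

theorem chi_add (θ ω ω' : ZMod n → ZMod 2) : chi θ (ω + ω') = chi θ ω * chi θ ω' := by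
  have key : ∀ a b : ZMod 2, ((-1 : ℂ)) ^ (a + b).val = (-1) ^ a.val * (-1) ^ b.val := by
    intro a b
    rw [ZMod.val_add, ← pow_add]
    exact (pow_eq_pow_mod _ (by norm_num)).symm
  simp only [chi, Pi.add_apply, mul_add, Finset.sum_add_distrib, key]

theorem chi_zero (θ : ZMod n → ZMod 2) : chi θ 0 = 1 := by simp [chi]

theorem chi_translate (θ ω : ZMod n → ZMod 2) {h : ZMod n} (hh : h ∈ perSub θ) :
    chi θ (translate h ω) = chi θ ω := by
  unfold chi translate
  congr 2
  rw [← Equiv.sum_comp (Equiv.addRight h)]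
  refine Finset.sum_congr rfl fun k _ => ?_
  simp [add_mem_perSub θ hh]

/-- The extension `χ̃_θ` of `χ_θ` to `C₂ ≀ ⟨t(θ)⟩`: `χ̃_θ(ω, h) = χ_θ(ω)`. -/
def chiExt (θ : ZMod n → ZMod 2) : inertia θ →* ℂ where
  toFun g := chi θ (lamps (g : Wreath n))
  map_one' := by rw [Subgroup.coe_one, lamps_one, chi_zero]
  map_mul' g h := by rw [Subgroup.coe_mul, lamps_mul, chi_add, chi_translate θ _ g.2]

/-- The inflation of `e_r|_{⟨t(θ)⟩}` to `C₂ ≀ ⟨t(θ)⟩`: `(ω, h) ↦ e_r(h)`. -/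
def eInfl (θ : ZMod n → ZMod 2) (r : ℕ) : inertia θ →* ℂ where
  toFun g := e r (pos (g : Wreath n))
  map_one' := by simp [pos_one, e]
  map_mul' g h := by
    simp only [e, Subgroup.coe_mul, pos_mul, mul_add, AddChar.map_add_eq_mul]

/-- The representation of `C₂ ≀ Cₙ` induced from the character `χ̃_θ ⊗ (e_r|_{⟨t⟩})^#`
of `C₂ ≀ ⟨t(θ)⟩`. -/
def indRep (θ : ZMod n → ZMod 2) (r : ℕ) :
    Representation ℂ (Wreath n)
      (Representation.IndV (inertia θ).subtype (charRep (chiExt θ * eInfl θ r))) :=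
  Representation.ind (inertia θ).subtype (charRep (chiExt θ * eInfl θ r))

/-! ### The vectors `f_{r,s}`, `φ_{r,j}` and the induced pieces -/

/-- The number `m(θ) = n / t(θ)`. -/
def mult (θ : ZMod n → ZMod 2) : ℕ := n / period θ

/-- `f_{r,s}(k) = e_{m-r}(k - s)` if `k ∈ s + ⟨t⟩`, and `0` otherwise. -/
def fvec (θ : ZMod n → ZMod 2) (r : ℕ) (s : ℕ) (k : ZMod n) : ℂ :=
  if k - (s : ZMod n) ∈ perSub θ then e (mult θ - r) (k - (s : ZMod n)) else 0

/-- `φ_0, …, φ_{t-1}` is an orthogonal basis of `⟨f_{r,0}, …, f_{r,t-1}⟩` that consists of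
eigenvectors of `M_θ`, with eigenvalues `μ_0, …, μ_{t-1}`. -/
structure IsEigenbasis (θ : ZMod n → ZMod 2) (r : ℕ) (φ : Fin (period θ) → ZMod n → ℂ)
    (μ : Fin (period θ) → ℂ) : Prop where
  ne_zero : ∀ j, φ j ≠ 0
  orthogonal : ∀ i j, i ≠ j → scalarProd (φ i) (φ j) = 0
  span_eq : Submodule.span ℂ (Set.range φ) =
    Submodule.span ℂ (Set.range fun s : Fin (period θ) => fvec θ r s)
  eigen : ∀ j, thetaOp θ (φ j) = μ j • φ j

/-- The induced space `⨁_{s=0}^{t-1} ⟨χ_{sθ} ⊗ s φ⟩`. -/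
def piece (θ : ZMod n → ZMod 2) (φ : ZMod n → ℂ) : Submodule ℂ (Wreath n → ℂ) :=
  Submodule.span ℂ (Set.range fun s : Fin (period θ) =>
    tens (chi (translate ((s : ℕ) : ZMod n) θ)) (translate ((s : ℕ) : ZMod n) φ))

end

/-! ### The path and circle spectra -/

/-- The spectrum `cos (hπ / (l + 1))`, `1 ≤ h ≤ l`, of half the adjacency operator of the path
with `l` vertices. -/
def pathSpectrum (l : ℕ) : Multiset ℝ :=
  (Finset.Icc 1 l).val.map fun h => Real.cos (h * Real.pi / (l + 1))

/-- If the edge to the left of `a` is deleted (`θ(a - 1) = 1`), this is the number of vertices of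
the path `{a, a + 1, …}` that starts at `a` in the graph obtained from the circle by deleting the
edges `{k, k + 1}` with `θ(k) = 1`. -/
def pathLength (θ : ZMod n → ZMod 2) (a : ZMod n) : ℕ :=
  sInf {l : ℕ | 0 < l ∧ θ (a + (l : ZMod n) - 1) = 1}

/-- The eigenvalues of `M_θ` on `⟨f_{r,0}, …, f_{r,t-1}⟩`, with multiplicity. For `θ = 0`
(so `t = 1`) it is the `r`-th eigenvalue of the circle; for `θ ≠ 0` it is the union of the spectra
of the paths that start at one of `0, …, t - 1`. -/
def thetaSpectrum (θ : ZMod n → ZMod 2) (r : ℕ) : Multiset ℝ :=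
  if θ = 0 then {Real.cos (2 * Real.pi * r / n)}
  else ∑ a ∈ (Finset.range (period θ)).filter (fun a : ℕ => θ ((a : ZMod n) - 1) = 1),
    pathSpectrum (pathLength θ (a : ZMod n))

end CircleLamp

end

open CircleLamp

namespace CircleLamp

open scoped Classical ComplexConjugate

section

variable {n : ℕ}

/-! ### Translations -/

/-! The argument is the little group method, carried out with explicit functions. An element `(ω,
x)` sends `χ_θ ⊗ f` to a multiple of `χ_{xθ} ⊗ xf` (`regRep_tens`), so `C₂ ≀ ⟨t⟩` fixes the
character `χ_θ`. The span of the `f_{r,s}` is the space `Q` of functions `f` with `hf = e_r(h) f`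
for `h ∈ ⟨t⟩` (`span_fvec`), and the `χ_θ ⊗ f` with `f ∈ Q` are exactly the functions on which `C₂ ≀
⟨t⟩` acts by the inducing character (`regRep_inertia_tens`, `exists_tens_of_regRep_inertia`).

By Frobenius reciprocity every copy of the induced representation in `L(C₂ ≀ Cₙ)` is generated by
such a function, so the isotypic component is the sum of the `W_j` for any basis of `Q`
(`isotypic_le`). Each `W_j` is irreducible because the characters `χ_{sθ}`, `0 ≤ s < t`, are
distinct: averaging against one of them isolates one generator, whose translates give the others
(`piece_le_of_mem`).

A step of the walk randomises the lamp of the crossed edge. Against `χ_θ` the two lamp values add up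
if the edge has label 0 and cancel if it has label 1, hence `𝓜 (χ_θ ⊗ f) = χ_θ ⊗ M_θ f`
(`lampOp_tens`).

On `Q` the functions `f_{r,s}` play the role of the vertices of the circle modulo `t`. For `θ ≠ 0`
the edges with label 1 cut it into paths, whose eigenvectors are sines vanishing just beyond both
ends (`thetaOp_pathVec`); for `θ = 0` the space is a line spanned by a character. This explicit
eigenbasis suffices for an arbitrary one, since the eigenvalues are the roots of a characteristic
polynomial (`IsEigenbasis.map_eq`). -/

theorem translate_translate {A : Type*} (s u : ZMod n) (f : ZMod n → A) :
    translate s (translate u f) = translate (s + u) f := by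
  funext k
  simp only [translate]
  congr 1
  ring

theorem translate_zero {A : Type*} (f : ZMod n → A) : translate 0 f = f := by
  funext k
  simp [translate]

variable [NeZero n]

/-! ### The period -/

/-- The remainder of `d` modulo the period would be a smaller positive period. -/
theorem period_dvd_of_forall {θ : ZMod n → ZMod 2} {d : ℕ} (hd : ∀ k : ZMod n, θ (k + d) = θ k) :
    period θ ∣ d := by
  by_contra hnd
  have hpos : 0 < d % period θ := Nat.pos_of_ne_zero fun h => hnd (Nat.dvd_of_mod_eq_zero h)
  have hmem : d % period θ ∈ {t : ℕ | 0 < t ∧ ∀ k : ZMod n, θ (k + t) = θ k} := by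
    refine ⟨hpos, fun k => ?_⟩
    have hP : ((period θ * (d / period θ) : ℕ) : ZMod n) ∈ perSub θ := by
      rw [Nat.mul_comm, Nat.cast_mul, ← nsmul_eq_mul]
      exact AddSubgroup.nsmul_mem_zmultiples _ _
    have h := add_mem_perSub θ hP (k + (d % period θ : ℕ))
    rw [← h, add_assoc, ← Nat.cast_add, Nat.mod_add_div]
    exact hd k
  have hle : period θ ≤ d % period θ := Nat.sInf_le hmem
  exact absurd (Nat.mod_lt d (period_spec θ).1) (not_lt.mpr hle)

theorem period_dvd (θ : ZMod n → ZMod 2) : period θ ∣ n :=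
  period_dvd_of_forall fun k => by simp

theorem natCast_mem_perSub {θ : ZMod n → ZMod 2} {d : ℕ} :
    (d : ZMod n) ∈ perSub θ ↔ period θ ∣ d := by
  refine ⟨fun h => period_dvd_of_forall fun k => add_mem_perSub θ h k, ?_⟩
  rintro ⟨c, rfl⟩
  rw [Nat.mul_comm, Nat.cast_mul, ← nsmul_eq_mul]
  exact AddSubgroup.nsmul_mem_zmultiples _ _

theorem mem_perSub_of_forall {θ : ZMod n → ZMod 2} {h : ZMod n} (hh : ∀ k, θ (k + h) = θ k) :
    h ∈ perSub θ := by
  rw [← ZMod.natCast_zmod_val h, natCast_mem_perSub]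
  exact period_dvd_of_forall fun k => by rw [ZMod.natCast_zmod_val]; exact hh k

/-- With `exists_sub_mem_perSub`, this makes `0, …, t - 1` a transversal of `⟨t⟩` in `Cₙ`. -/
theorem eq_of_sub_mem_perSub {θ : ZMod n → ZMod 2} {i j : ℕ} (hi : i < period θ)
    (hj : j < period θ) (h : (i : ZMod n) - j ∈ perSub θ) : i = j := by
  wlog hij : j ≤ i generalizing i j
  · exact (this hj hi (by rw [← neg_sub]; exact neg_mem h) (by omega)).symm
  rw [← Nat.cast_sub hij, natCast_mem_perSub] at h
  have := Nat.eq_zero_of_dvd_of_lt h (by omega)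
  omega

theorem exists_sub_mem_perSub (θ : ZMod n → ZMod 2) (x : ZMod n) :
    ∃ i : Fin (period θ), x - ((i : ℕ) : ZMod n) ∈ perSub θ := by
  refine ⟨⟨x.val % period θ, Nat.mod_lt _ (period_spec θ).1⟩, ?_⟩
  have h : x - ((x.val % period θ : ℕ) : ZMod n) =
      ((period θ * (x.val / period θ) : ℕ) : ZMod n) := by
    rw [sub_eq_iff_eq_add, ← Nat.cast_add, Nat.div_add_mod, ZMod.natCast_zmod_val]
  rw [h, natCast_mem_perSub]
  exact dvd_mul_right _ _

theorem mult_mul_mem_perSub {θ : ZMod n → ZMod 2} {h : ZMod n} (hh : h ∈ perSub θ) :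
    (mult θ : ZMod n) * h = 0 := by
  obtain ⟨z, rfl⟩ := AddSubgroup.mem_zmultiples_iff.mp hh
  rw [zsmul_eq_mul, mul_left_comm, ← Nat.cast_mul, mult, Nat.div_mul_cancel (period_dvd θ)]
  simp

theorem translate_perSub {θ : ZMod n → ZMod 2} {h : ZMod n} (hh : h ∈ perSub θ) :
    translate h θ = θ := by
  funext k
  rw [translate, ← add_mem_perSub θ hh (k - h), sub_add_cancel]

theorem translate_natCast_injective {θ : ZMod n → ZMod 2} {i j : ℕ} (hi : i < period θ)
    (hj : j < period θ) (h : translate (i : ZMod n) θ = translate (j : ZMod n) θ) : i = j := by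
  refine eq_of_sub_mem_perSub hi hj (mem_perSub_of_forall fun k => ?_)
  have := congrFun h (k + i)
  simp only [translate, add_sub_cancel_right] at this
  rw [this]
  congr 1
  ring

/-! ### The characters of the cyclic group -/

theorem e_add (r : ℕ) (a b : ZMod n) : e r (a + b) = e r a * e r b := by
  simp only [e, mul_add, AddChar.map_add_eq_mul]

theorem e_zero (r : ℕ) : e r (0 : ZMod n) = 1 := by simp [e]

theorem e_neg_mul (r : ℕ) (a : ZMod n) : e r (-a) * e r a = 1 := by
  rw [← e_add, neg_add_cancel, e_zero]

/-- Since `m t = n`, multiplication by `m` kills `⟨t⟩`, so the index `m - r` acts there as `-r`. The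
bound on `r` keeps the natural subtraction from truncating. -/
theorem e_mult_sub {θ : ZMod n → ZMod 2} {r : ℕ} (hr : r < mult θ) {h : ZMod n}
    (hh : h ∈ perSub θ) : e (mult θ - r) h = e r (-h) := by
  unfold e
  rw [Nat.cast_sub hr.le, sub_mul, mult_mul_mem_perSub hh, zero_sub, mul_neg]

/-! ### Quasi-periodic functions -/

/-- The functions `f` on the circle with `h f = e_r(h) f` for all `h` in `⟨t(θ)⟩`. -/
def quasiPeriodic (θ : ZMod n → ZMod 2) (r : ℕ) : Submodule ℂ (ZMod n → ℂ) where
  carrier := {f | ∀ h ∈ perSub θ, ∀ k, f (k - h) = e r h * f k}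
  add_mem' {f g} hf hg h hh k := by
    simp only [Pi.add_apply, hf h hh k, hg h hh k, mul_add]
  zero_mem' h hh k := by simp
  smul_mem' c f hf h hh k := by
    simp only [Pi.smul_apply, hf h hh k, smul_eq_mul]
    ring

theorem mem_quasiPeriodic {θ : ZMod n → ZMod 2} {r : ℕ} {f : ZMod n → ℂ} :
    f ∈ quasiPeriodic θ r ↔ ∀ h ∈ perSub θ, ∀ k, f (k - h) = e r h * f k := Iff.rfl

/-- The function `f_{r,s}`, with the position `s` taken in the circle. -/
noncomputable def bump (θ : ZMod n → ZMod 2) (r : ℕ) (s : ZMod n) (k : ZMod n) : ℂ :=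
  if k - s ∈ perSub θ then e r (s - k) else 0

theorem fvec_eq_bump {θ : ZMod n → ZMod 2} {r : ℕ} (hr : r < mult θ) (s : ℕ) :
    fvec θ r s = bump θ r s := by
  funext k
  unfold fvec bump
  split_ifs with h
  · rw [e_mult_sub hr h, neg_sub]
  · rfl

theorem bump_mem_quasiPeriodic (θ : ZMod n → ZMod 2) (r : ℕ) (s : ZMod n) :
    bump θ r s ∈ quasiPeriodic θ r := by
  intro h hh k
  have hiff : k - h - s ∈ perSub θ ↔ k - s ∈ perSub θ := by
    rw [sub_right_comm]
    exact ⟨fun H => by simpa using add_mem H hh, fun H => sub_mem H hh⟩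
  unfold bump
  simp only [hiff]
  split_ifs
  · rw [← e_add]
    congr 1
    ring
  · simp

/-- At each point a single residue contributes, and quasi-periodicity recovers the value there from
the value at the representative. -/
theorem sum_smul_bump {θ : ZMod n → ZMod 2} {r : ℕ} {f : ZMod n → ℂ}
    (hf : f ∈ quasiPeriodic θ r) :
    f = ∑ s : Fin (period θ), f ((s : ℕ) : ZMod n) • bump θ r ((s : ℕ) : ZMod n) := by
  funext x
  obtain ⟨i, hi⟩ := exists_sub_mem_perSub θ x
  rw [Finset.sum_apply, Finset.sum_eq_single i]
  · have h := hf _ hi x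
    rw [sub_sub_cancel] at h
    rw [Pi.smul_apply, bump, if_pos hi, h, smul_eq_mul, mul_right_comm, ← e_add]
    simp [e_zero]
  · intro j _ hji
    rw [Pi.smul_apply, bump, if_neg, smul_zero]
    intro hj
    refine hji (Fin.ext (eq_of_sub_mem_perSub j.2 i.2 ?_))
    have := sub_mem hi hj
    rwa [sub_sub_sub_cancel_left] at this
  · simp

theorem span_fvec {θ : ZMod n → ZMod 2} {r : ℕ} (hr : r < mult θ) :
    Submodule.span ℂ (Set.range fun s : Fin (period θ) => fvec θ r s) = quasiPeriodic θ r := by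
  simp only [fvec_eq_bump hr]
  refine le_antisymm (Submodule.span_le.mpr ?_) fun f hf => ?_
  · rintro _ ⟨s, rfl⟩
    exact bump_mem_quasiPeriodic θ r _
  · rw [sum_smul_bump hf]
    exact sum_mem fun s _ => Submodule.smul_mem _ _ (Submodule.subset_span ⟨s, rfl⟩)

theorem translate_quasiPeriodic {θ : ZMod n → ZMod 2} {r : ℕ} {f : ZMod n → ℂ}
    (hf : f ∈ quasiPeriodic θ r) {h : ZMod n} (hh : h ∈ perSub θ) : translate h f = e r h • f :=
  funext fun k => hf h hh k

/-! ### The scalar product -/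

section scalarProd

variable {X : Type*} [Fintype X]

theorem scalarProd_add_left (f f' g : X → ℂ) :
    scalarProd (f + f') g = scalarProd f g + scalarProd f' g := by
  simp [scalarProd, add_mul, Finset.sum_add_distrib]

theorem scalarProd_smul_left (c : ℂ) (f g : X → ℂ) :
    scalarProd (c • f) g = c * scalarProd f g := by
  simp [scalarProd, Finset.mul_sum, mul_assoc]

theorem scalarProd_conj (f g : X → ℂ) : conj (scalarProd f g) = scalarProd g f := by
  simp [scalarProd, mul_comm]

theorem scalarProd_smul_right (c : ℂ) (f g : X → ℂ) :
    scalarProd f (c • g) = conj c * scalarProd f g := by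
  simp only [scalarProd, Finset.mul_sum, Pi.smul_apply, smul_eq_mul, map_mul]
  exact Finset.sum_congr rfl fun x _ => by ring

theorem scalarProd_self_eq_zero {f : X → ℂ} : scalarProd f f = 0 ↔ f = 0 := by
  refine ⟨fun h => ?_, fun h => by simp [h, scalarProd]⟩
  have h' : ∑ x, Complex.normSq (f x) = 0 := by
    have := h
    simp only [scalarProd, Complex.mul_conj] at this
    exact_mod_cast this
  rw [Finset.sum_eq_zero_iff_of_nonneg fun _ _ => Complex.normSq_nonneg _] at h'
  funext x
  exact Complex.normSq_eq_zero.mp (h' x (Finset.mem_univ x))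

/-- The linear form `f ↦ ⟨f, g⟩`. -/
def scalarProdLeft (g : X → ℂ) : (X → ℂ) →ₗ[ℂ] ℂ where
  toFun f := scalarProd f g
  map_add' f f' := scalarProd_add_left f f' g
  map_smul' c f := scalarProd_smul_left c f g

theorem scalarProd_eq_zero_of_mem_span {S T : Set (X → ℂ)}
    (h : ∀ f ∈ S, ∀ g ∈ T, scalarProd f g = 0) {f g : X → ℂ} (hf : f ∈ Submodule.span ℂ S)
    (hg : g ∈ Submodule.span ℂ T) : scalarProd f g = 0 := by
  have h1 : ∀ g ∈ T, ∀ f ∈ Submodule.span ℂ S, scalarProd f g = 0 := fun g hg f hf =>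
    (Submodule.span_le (p := LinearMap.ker (scalarProdLeft g))).mpr (fun f hf => h f hf g hg) hf
  rw [← scalarProd_conj]
  refine (map_eq_zero _).mpr
    ((Submodule.span_le (p := LinearMap.ker (scalarProdLeft f))).mpr (fun g hg => ?_) hg)
  change scalarProd g f = 0
  rw [← scalarProd_conj, h1 g hg f hf, map_zero]

theorem linearIndependent_of_orthogonal {ι : Type*} {v : ι → X → ℂ} (h0 : ∀ i, v i ≠ 0)
    (h : ∀ i j, i ≠ j → scalarProd (v i) (v j) = 0) : LinearIndependent ℂ v := by
  rw [linearIndependent_iff']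
  intro s c hc i hi
  have := congrArg (scalarProdLeft (v i)) hc
  rw [map_sum, map_zero, Finset.sum_eq_single_of_mem i hi fun j _ hj => ?_, map_smul] at this
  · exact (mul_eq_zero.mp this).resolve_right fun h' => h0 i (scalarProd_self_eq_zero.mp h')
  · rw [map_smul]
    exact mul_eq_zero_of_right _ (h j i hj)

theorem iSupIndep_of_orthogonal {ι : Type*} (p : ι → Submodule ℂ (X → ℂ))
    (h : ∀ i j, i ≠ j → ∀ f ∈ p i, ∀ g ∈ p j, scalarProd f g = 0) : iSupIndep p := by
  intro i
  rw [Submodule.disjoint_def]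
  intro f hf hf'
  refine scalarProd_self_eq_zero.mp ?_
  have : (⨆ (j) (_ : j ≠ i), p j) ≤ LinearMap.ker (scalarProdLeft f) :=
    iSup₂_le fun j hj g hg => h j i hj g hg f hf
  exact this hf'

theorem scalarProd_translate (s : ZMod n) (f g : ZMod n → ℂ) :
    scalarProd (translate s f) (translate s g) = scalarProd f g :=
  Equiv.sum_comp (Equiv.subRight s) fun k => f k * conj (g k)

end scalarProd

end

section

/-! ### Elements of the wreath product -/

section wreath

variable {n : ℕ}

/-- The element `(ω, x)` of `C₂ ≀ Cₙ`. -/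
def wr (ω : ZMod n → ZMod 2) (x : ZMod n) : Wreath n :=
  ⟨fun k => Multiplicative.ofAdd (ω k.toAdd), Multiplicative.ofAdd x⟩

@[simp] theorem lamps_wr (ω : ZMod n → ZMod 2) (x : ZMod n) : lamps (wr ω x) = ω := rfl

@[simp] theorem pos_wr (ω : ZMod n → ZMod 2) (x : ZMod n) : pos (wr ω x) = x := rfl

theorem wr_lamps_pos (g : Wreath n) : wr (lamps g) (pos g) = g := rfl

theorem wreath_ext {g h : Wreath n} (hl : lamps g = lamps h) (hp : pos g = pos h) : g = h := by
  rw [← wr_lamps_pos g, ← wr_lamps_pos h, hl, hp]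

theorem pos_inv (g : Wreath n) : pos g⁻¹ = -pos g := rfl

theorem zmod_two_eq_zero_or_one (a : ZMod 2) : a = 0 ∨ a = 1 := by
  revert a
  decide

theorem neg_eq_self_of_zmod_two {X : Type*} (ω : X → ZMod 2) : -ω = ω :=
  funext fun k => CharTwo.neg_eq (ω k)

theorem lamps_inv (g : Wreath n) : lamps g⁻¹ = translate (-pos g) (lamps g) := by
  have h := lamps_mul g⁻¹ g
  rw [inv_mul_cancel, lamps_one, pos_inv] at h
  rw [← neg_eq_self_of_zmod_two (translate _ _)]
  exact eq_neg_of_add_eq_zero_left h.symm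

/-- The group `C₂ ≀ Cₙ` as the set of pairs `(ω, x)`. -/
def wreathEquiv (n : ℕ) : Wreath n ≃ (ZMod n → ZMod 2) × ZMod n where
  toFun g := (lamps g, pos g)
  invFun p := wr p.1 p.2
  left_inv _ := rfl
  right_inv _ := rfl

theorem regRep_apply (g : Wreath n) (F : Wreath n → ℂ) (x : Wreath n) :
    regRep (Wreath n) g F x = F (g⁻¹ * x) := rfl

end wreath

/-! ### The circle -/

section circle

variable {n : ℕ}

theorem one_ne_zero_zmod (hn : 3 ≤ n) : (1 : ZMod n) ≠ 0 := by
  have : Fact (1 < n) := ⟨by omega⟩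
  exact one_ne_zero

theorem add_one_ne_sub_one (hn : 3 ≤ n) (x : ZMod n) : x + 1 ≠ x - 1 := by
  intro h
  have h2 : ((2 : ℕ) : ZMod n) = 0 := by
    push_cast
    linear_combination h
  rw [ZMod.natCast_eq_zero_iff] at h2
  exact absurd (Nat.le_of_dvd (by norm_num) h2) (by omega)

theorem circle_adj (hn : 3 ≤ n) (x y : ZMod n) : (circle n).Adj x y ↔ y = x + 1 ∨ y = x - 1 := by
  have h1 := one_ne_zero_zmod hn
  simp only [circle, SimpleGraph.circulantGraph_adj, Set.mem_singleton_iff]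
  constructor
  · rintro ⟨-, h | h⟩
    · exact Or.inr (by linear_combination -h)
    · exact Or.inl (by linear_combination h)
  · rintro (rfl | rfl)
    · exact ⟨by simpa using h1, by simp⟩
    · exact ⟨fun h => h1 (by linear_combination h), by simp⟩

/-- The other matching of endpoints, `k = x + 1` and `k + 1 = x`, would force `2 = 0`, which `3 ≤ n`
excludes. So an edge carries exactly one lamp. -/
theorem edgeOf_eq_add_one (hn : 3 ≤ n) (k x : ZMod n) : edgeOf k = s(x, x + 1) ↔ k = x := by
  rw [edgeOf, Sym2.eq_iff]
  refine ⟨?_, fun h => Or.inl ⟨h, by rw [h]⟩⟩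
  rintro (⟨h, -⟩ | ⟨rfl, h⟩)
  · exact h
  · exact absurd (by linear_combination h) (add_one_ne_sub_one hn x)

theorem edgeOf_eq_sub_one (hn : 3 ≤ n) (k x : ZMod n) : edgeOf k = s(x, x - 1) ↔ k = x - 1 := by
  rw [Sym2.eq_swap, ← edgeOf_eq_add_one hn k (x - 1), sub_add_cancel]

/-- Only the lamp of the crossed edge is free, and a free value in `ZMod 2` is either the old one or
the old one plus 1. -/
theorem lampGraph_adj (hn : 3 ≤ n) (g h : Wreath n) : (lampGraph n).Adj g h ↔
    h ∈ ({wr (lamps g) (pos g + 1), wr (lamps g + Pi.single (pos g) 1) (pos g + 1),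
      wr (lamps g) (pos g - 1), wr (lamps g + Pi.single (pos g - 1) 1) (pos g - 1)} :
        Finset (Wreath n)) := by
  have key : ∀ (ω ω' : ZMod n → ZMod 2) (p : ZMod n),
      (∀ k, k ≠ p → ω k = ω' k) ↔ ω' = ω ∨ ω' = ω + Pi.single p 1 := by
    intro ω ω' p
    constructor
    · intro H
      have h2 : ∀ a b : ZMod 2, a = b ∨ a = b + 1 := by decide
      rcases h2 (ω' p) (ω p) with h | h
      · left
        funext k
        by_cases hk : k = p
        · rw [hk, h]
        · exact (H k hk).symm
      · right
        funext k
        by_cases hk : k = p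
        · rw [hk, h]; simp
        · rw [← H k hk]; simp [hk]
    · rintro (rfl | rfl) k hk
      · rfl
      · simp [hk]
  have hext : ∀ ω x, h = wr ω x ↔ pos h = x ∧ lamps h = ω := fun ω x =>
    ⟨fun H => by simp [H], fun H => wreath_ext H.2 H.1⟩
  change (circle n).Adj (pos g) (pos h) ∧ _ ↔ _
  rw [circle_adj hn]
  simp only [Finset.mem_insert, Finset.mem_singleton, hext]
  rw [← or_assoc, ← and_or_left, ← key, ← and_or_left, ← key, or_and_right]
  refine or_congr (and_congr_right fun H => ?_) (and_congr_right fun H => ?_)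
  · simp only [H, ne_eq, edgeOf_eq_add_one hn]
  · simp only [H, ne_eq, edgeOf_eq_sub_one hn]

end circle

variable {n : ℕ} [NeZero n]

/-! ### The characters of the lamp group -/

theorem chi_eq_one_or (θ ω : ZMod n → ZMod 2) : chi θ ω = 1 ∨ chi θ ω = -1 :=
  neg_one_pow_eq_or ℂ _

theorem chi_mul_self (θ ω : ZMod n → ZMod 2) : chi θ ω * chi θ ω = 1 := by
  rcases chi_eq_one_or θ ω with h | h <;> simp [h]

theorem chi_ne_zero (θ ω : ZMod n → ZMod 2) : chi θ ω ≠ 0 :=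
  left_ne_zero_of_mul_eq_one (chi_mul_self θ ω)

theorem conj_chi (θ ω : ZMod n → ZMod 2) : conj (chi θ ω) = chi θ ω := by
  rcases chi_eq_one_or θ ω with h | h <;> simp [h]

theorem chi_translate_neg (θ ω : ZMod n → ZMod 2) (s : ZMod n) :
    chi θ (translate (-s) ω) = chi (translate s θ) ω := by
  unfold chi translate
  congr 2
  rw [← Equiv.sum_comp (Equiv.subRight s)]
  refine Finset.sum_congr rfl fun k _ => ?_
  simp

theorem chi_single (θ : ZMod n → ZMod 2) (k : ZMod n) :
    chi θ (Pi.single k 1) = if θ k = 0 then 1 else -1 := by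
  have : ∑ j, θ j * (Pi.single k 1 : ZMod n → ZMod 2) j = θ k := by
    rw [Finset.sum_eq_single k] <;> simp +contextual
  rw [chi, this]
  rcases zmod_two_eq_zero_or_one (θ k) with h | h
  · simp [h]
  · have h1 : (1 : ZMod 2).val = 1 := rfl
    simp [h, h1]

/-- Flipping a lamp where `θ` and `θ'` differ permutes the configurations and negates every summand.
-/
theorem sum_chi_mul_chi {θ θ' : ZMod n → ZMod 2} (h : θ ≠ θ') :
    ∑ ω, chi θ ω * chi θ' ω = 0 := by
  obtain ⟨k, hk⟩ := Function.ne_iff.mp h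
  have hneg : chi θ (Pi.single k 1) * chi θ' (Pi.single k 1) = -1 := by
    rw [chi_single, chi_single]
    rcases zmod_two_eq_zero_or_one (θ k) with h1 | h1 <;>
      rcases zmod_two_eq_zero_or_one (θ' k) with h2 | h2 <;>
      simp_all
  have hsum : ∑ ω, chi θ ω * chi θ' ω = -∑ ω, chi θ ω * chi θ' ω := by
    rw [← Finset.sum_neg_distrib, ← Equiv.sum_comp (Equiv.addRight (Pi.single k 1))]
    refine Finset.sum_congr rfl fun ω _ => ?_
    rw [Equiv.coe_addRight, chi_add, chi_add, mul_mul_mul_comm, hneg, mul_neg_one]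
  exact self_eq_neg.mp hsum

theorem sum_chi_mul_self (θ : ZMod n → ZMod 2) :
    ∑ ω, chi θ ω * chi θ ω = (Fintype.card (ZMod n → ZMod 2) : ℂ) := by
  simp [chi_mul_self]

/-! ### The functions `χ ⊗ f` -/

theorem scalarProd_tens (θ θ' : ZMod n → ZMod 2) (f f' : ZMod n → ℂ) :
    scalarProd (tens (chi θ) f) (tens (chi θ') f') =
      (∑ ω, chi θ ω * chi θ' ω) * scalarProd f f' := by
  rw [scalarProd, ← Equiv.sum_comp (wreathEquiv n).symm, Fintype.sum_prod_type, scalarProd,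
    Finset.sum_mul_sum]
  refine Finset.sum_congr rfl fun ω _ => Finset.sum_congr rfl fun x _ => ?_
  change chi θ ω * f x * conj (chi θ' ω * f' x) = _
  rw [map_mul, conj_chi]
  ring

/-- The linear map `f ↦ χ_θ ⊗ f`. -/
noncomputable def tensMap (θ : ZMod n → ZMod 2) : (ZMod n → ℂ) →ₗ[ℂ] (Wreath n → ℂ) where
  toFun f := tens (chi θ) f
  map_add' _ _ := funext fun _ => mul_add _ _ _
  map_smul' _ _ := funext fun _ => mul_left_comm _ _ _

theorem tens_smul (θ : ZMod n → ZMod 2) (c : ℂ) (f : ZMod n → ℂ) :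
    tens (chi θ) (c • f) = c • tens (chi θ) f := (tensMap θ).map_smul c f

theorem tens_ne_zero (θ : ZMod n → ZMod 2) {f : ZMod n → ℂ} (hf : f ≠ 0) :
    tens (chi θ) f ≠ 0 := by
  obtain ⟨x, hx⟩ := Function.ne_iff.mp hf
  exact Function.ne_iff.mpr ⟨wr 0 x, mul_ne_zero (chi_ne_zero _ _) hx⟩

/-- No conjugate character appears: inverting the lamps only translates them, because `-ω = ω` in
characteristic 2. -/
theorem regRep_tens (g : Wreath n) (θ : ZMod n → ZMod 2) (f : ZMod n → ℂ) :
    regRep (Wreath n) g (tens (chi θ) f) = chi (translate (pos g) θ) (lamps g) •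
      tens (chi (translate (pos g) θ)) (translate (pos g) f) := by
  funext x
  rw [regRep_apply, Pi.smul_apply, smul_eq_mul, tens, tens, lamps_mul, pos_mul, lamps_inv,
    pos_inv, chi_add, chi_translate_neg, chi_translate_neg, mul_assoc, translate, neg_add_eq_sub]

/-! ### Neighbours -/

theorem circle_neighborFinset (hn : 3 ≤ n) (x : ZMod n) :
    (circle n).neighborFinset x = {x + 1, x - 1} := by
  ext y
  rw [SimpleGraph.mem_neighborFinset, circle_adj hn, Finset.mem_insert, Finset.mem_singleton]

theorem circle_degree (hn : 3 ≤ n) (x : ZMod n) : (circle n).degree x = 2 := by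
  rw [← SimpleGraph.card_neighborFinset_eq_degree, circle_neighborFinset hn,
    Finset.card_pair (add_one_ne_sub_one hn x)]

theorem thetaOp_apply (hn : 3 ≤ n) (θ : ZMod n → ZMod 2) (f : ZMod n → ℂ) (x : ZMod n) :
    thetaOp θ f x = 1 / 2 *
      ((if θ x = 0 then f (x + 1) else 0) + if θ (x - 1) = 0 then f (x - 1) else 0) := by
  have hsum : ∑ y, (if (circle n).Adj x y ∧ (∀ k, edgeOf k = s(x, y) → θ k = 0) then f y else 0) =
      ∑ y ∈ (circle n).neighborFinset x,
        if ∀ k, edgeOf k = s(x, y) → θ k = 0 then f y else 0 := by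
    simp only [ite_and]
    rw [← Finset.sum_filter]
    congr 1
    ext y
    simp
  rw [thetaOp, hsum, circle_degree hn, circle_neighborFinset hn,
    Finset.sum_pair (add_one_ne_sub_one hn x)]
  simp only [edgeOf_eq_add_one hn, edgeOf_eq_sub_one hn, forall_eq, Nat.cast_ofNat]

/-- Two directions times two lamp values give degree 4. The directions lead to different positions
because `3 ≤ n`. -/
theorem lampOp_apply (hn : 3 ≤ n) (F : Wreath n → ℂ) (g : Wreath n) :
    lampOp n F g = 1 / 4 * (F (wr (lamps g) (pos g + 1)) +
      (F (wr (lamps g + Pi.single (pos g) 1) (pos g + 1)) + (F (wr (lamps g) (pos g - 1)) +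
        F (wr (lamps g + Pi.single (pos g - 1) 1) (pos g - 1))))) := by
  have hnb : (lampGraph n).neighborFinset g =
      {wr (lamps g) (pos g + 1), wr (lamps g + Pi.single (pos g) 1) (pos g + 1),
        wr (lamps g) (pos g - 1), wr (lamps g + Pi.single (pos g - 1) 1) (pos g - 1)} := by
    ext h
    rw [SimpleGraph.mem_neighborFinset, lampGraph_adj hn]
  have hp := add_one_ne_sub_one hn (pos g)
  have hpos : ∀ ω ω', wr ω (pos g + 1) ≠ wr ω' (pos g - 1) := fun ω ω' h => hp (congrArg pos h)
  have hlamps : ∀ p x y, wr (lamps g) x ≠ wr (lamps g + Pi.single p 1) y := fun p x y h => by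
    have := congrFun (congrArg lamps h) p
    simp at this
  have h1 : wr (lamps g) (pos g + 1) ∉ ({wr (lamps g + Pi.single (pos g) 1) (pos g + 1),
      wr (lamps g) (pos g - 1), wr (lamps g + Pi.single (pos g - 1) 1) (pos g - 1)} :
        Finset (Wreath n)) := by
    simp [hpos, hlamps]
  have h2 : wr (lamps g + Pi.single (pos g) 1) (pos g + 1) ∉ ({wr (lamps g) (pos g - 1),
      wr (lamps g + Pi.single (pos g - 1) 1) (pos g - 1)} : Finset (Wreath n)) := by
    simp [hpos]
  have h3 : wr (lamps g) (pos g - 1) ∉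
      ({wr (lamps g + Pi.single (pos g - 1) 1) (pos g - 1)} : Finset (Wreath n)) := by
    simp [hlamps]
  have hdeg : (lampGraph n).degree g = 4 := by
    rw [← SimpleGraph.card_neighborFinset_eq_degree, hnb, Finset.card_insert_of_notMem h1,
      Finset.card_insert_of_notMem h2, Finset.card_insert_of_notMem h3, Finset.card_singleton]
  have hsum : ∑ h, (if (lampGraph n).Adj g h then F h else 0) =
      ∑ h ∈ (lampGraph n).neighborFinset g, F h := by
    rw [← Finset.sum_filter]
    congr 1
    ext h
    simp
  change 1 / ((lampGraph n).degree g : ℂ) *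
    ∑ h, (if (lampGraph n).Adj g h then F h else 0) = _
  rw [hsum, hdeg, hnb, Finset.sum_insert h1, Finset.sum_insert h2, Finset.sum_insert h3,
    Finset.sum_singleton, Nat.cast_ofNat]

/-- Flipping the lamp `k` multiplies `χ_θ` by `1` or `-1` according to `θ k`, so the two terms for
each direction double or cancel. This turns the weight `1/4` into the `1/2` of `M_θ`. -/
theorem lampOp_tens (hn : 3 ≤ n) (θ : ZMod n → ZMod 2) (f : ZMod n → ℂ) :
    lampOp n (tens (chi θ) f) = tens (chi θ) (thetaOp θ f) := by
  funext g
  rw [lampOp_apply hn]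
  simp only [tens, thetaOp_apply hn, lamps_wr, pos_wr, chi_add, chi_single]
  split_ifs <;> ring

theorem thetaOp_translate (hn : 3 ≤ n) (θ : ZMod n → ZMod 2) (s : ZMod n) (f : ZMod n → ℂ) :
    thetaOp (translate s θ) (translate s f) = translate s (thetaOp θ f) := by
  funext x
  simp only [translate, thetaOp_apply hn, add_sub_right_comm, sub_right_comm]

/-- The operator `M_θ` as a linear map. -/
noncomputable def thetaMap (hn : 3 ≤ n) (θ : ZMod n → ZMod 2) : (ZMod n → ℂ) →ₗ[ℂ] (ZMod n → ℂ) where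
  toFun := thetaOp θ
  map_add' f g := by
    funext x
    simp only [thetaOp_apply hn, Pi.add_apply]
    split_ifs <;> ring
  map_smul' c f := by
    funext x
    simp only [thetaOp_apply hn, Pi.smul_apply, smul_eq_mul, RingHom.id_apply]
    split_ifs <;> ring

/-- An edge is kept or deleted for both of its directions at once; shifting the summation variable
exchanges right steps with left steps. -/
theorem scalarProd_thetaOp (hn : 3 ≤ n) (θ : ZMod n → ZMod 2) (f g : ZMod n → ℂ) :
    scalarProd (thetaOp θ f) g = scalarProd f (thetaOp θ g) := by
  have h1 : ∀ f g : ZMod n → ℂ, ∑ x, (if θ x = 0 then f (x + 1) else 0) * conj (g x) =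
      ∑ x, f x * conj (if θ (x - 1) = 0 then g (x - 1) else 0) := by
    intro f g
    rw [← Equiv.sum_comp (Equiv.subRight (1 : ZMod n))]
    refine Finset.sum_congr rfl fun x _ => ?_
    simp only [Equiv.subRight_apply, sub_add_cancel]
    split_ifs <;> simp
  have h2 : ∀ f g : ZMod n → ℂ, ∑ x, (if θ (x - 1) = 0 then f (x - 1) else 0) * conj (g x) =
      ∑ x, f x * conj (if θ x = 0 then g (x + 1) else 0) := by
    intro f g
    rw [← Equiv.sum_comp (Equiv.addRight (1 : ZMod n))]
    refine Finset.sum_congr rfl fun x _ => ?_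
    simp only [Equiv.coe_addRight, add_sub_cancel_right]
    split_ifs <;> simp
  simp only [scalarProd, thetaOp_apply hn, map_mul, map_add, mul_add, add_mul, mul_assoc,
    Finset.sum_add_distrib, ← Finset.mul_sum, h1, h2]
  simp only [Finset.mul_sum, map_div₀, map_one, map_ofNat]
  rw [add_comm]
  congr 1 <;> exact Finset.sum_congr rfl fun x _ => by ring

end

section

variable {n : ℕ}

/-! ### Path lengths and the path spectra indexed by vertices -/

theorem eq_zero_of_lt_pathLength {θ : ZMod n → ZMod 2} {a : ZMod n} {d : ℕ} (h0 : 0 < d)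
    (hd : d < pathLength θ a) : θ (a + (d : ZMod n) - 1) = 0 :=
  (zmod_two_eq_zero_or_one _).resolve_right fun h => Nat.notMem_of_lt_sInf hd ⟨h0, h⟩

/-- The starting points of the paths. -/
noncomputable def starts (θ : ZMod n → ZMod 2) : Finset ℕ :=
  (Finset.range (period θ)).filter fun a : ℕ => θ ((a : ZMod n) - 1) = 1

theorem starts_spec {θ : ZMod n → ZMod 2} (a : starts θ) :
    (a : ℕ) < period θ ∧ θ (((a : ℕ) : ZMod n) - 1) = 1 := by
  simpa [starts] using a.2

/-- The pairs of a path and a number below its length. -/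
abbrev PathIndex (θ : ZMod n → ZMod 2) : Type :=
  Σ a : starts θ, Fin (pathLength θ ((a : ℕ) : ZMod n))

/-- The angle `hπ / (l + 1)` with `h = i + 1`. -/
noncomputable def pathAngle (l i : ℕ) : ℝ := ((i + 1 : ℕ) : ℝ) * Real.pi / (l + 1)

theorem map_val_eq_sum_singleton {ι α : Type*} (s : Finset ι) (f : ι → α) :
    s.val.map f = ∑ i ∈ s, {f i} := by
  rw [Finset.sum_eq_multiset_sum, ← Multiset.sum_map_singleton (s.val.map f), Multiset.map_map]
  rfl

/-- This is the form in which the eigenvectors of the paths deliver the spectrum, with `h = i + 1`.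
-/
theorem map_thetaSpectrum {θ : ZMod n → ZMod 2} (hθ : θ ≠ 0) (r : ℕ) :
    (thetaSpectrum θ r).map (fun x : ℝ => (x : ℂ)) =
      Finset.univ.val.map fun p : PathIndex θ =>
        ((Real.cos (pathAngle (pathLength θ ((p.1 : ℕ) : ZMod n)) p.2) : ℝ) : ℂ) := by
  rw [thetaSpectrum, if_neg hθ, map_val_eq_sum_singleton, Fintype.sum_sigma]
  change _ = ∑ a : starts θ, ∑ i : Fin (pathLength θ ((a : ℕ) : ZMod n)),
    ({((Real.cos (pathAngle (pathLength θ ((a : ℕ) : ZMod n)) i) : ℝ) : ℂ)} : Multiset ℂ)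
  rw [Finset.sum_coe_sort (starts θ) fun a : ℕ =>
    ∑ i : Fin (pathLength θ (a : ZMod n)),
      ({((Real.cos (pathAngle (pathLength θ (a : ZMod n)) i) : ℝ) : ℂ)} : Multiset ℂ)]
  change Multiset.mapAddMonoidHom _ (∑ a ∈ starts θ, _) = _
  rw [map_sum]
  refine Finset.sum_congr rfl fun a _ => ?_
  rw [Fin.sum_univ_eq_sum_range fun i =>
    ({((Real.cos (pathAngle (pathLength θ (a : ZMod n)) i) : ℝ) : ℂ)} : Multiset ℂ),
    Multiset.coe_mapAddMonoidHom, pathSpectrum, Multiset.map_map]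
  -- The indices enter `pathSpectrum` as a multiset of naturals cast to reals by a bind with
  -- singletons.
  change Multiset.map _ (Multiset.bind _ fun h : ℕ => {(h : ℝ)}) = _
  rw [Multiset.bind_singleton, Multiset.map_map, map_val_eq_sum_singleton, Finset.range_eq_Ico]
  exact (Finset.sum_Ico_add' (fun i : ℕ => ({((Real.cos ((i : ℝ) * Real.pi /
    (pathLength θ (a : ZMod n) + 1)) : ℝ) : ℂ)} : Multiset ℂ)) 0 _ 1).symm

variable [NeZero n]

/-! ### Eigenbases -/

theorem IsEigenbasis.linearIndependent {θ : ZMod n → ZMod 2} {r : ℕ}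
    {φ : Fin (period θ) → ZMod n → ℂ} {μ : Fin (period θ) → ℂ} (h : IsEigenbasis θ r φ μ) :
    LinearIndependent ℂ φ :=
  linearIndependent_of_orthogonal h.ne_zero h.orthogonal

theorem IsEigenbasis.span_eq_quasiPeriodic {θ : ZMod n → ZMod 2} {r : ℕ} (hr : r < mult θ)
    {φ : Fin (period θ) → ZMod n → ℂ} {μ : Fin (period θ) → ℂ} (h : IsEigenbasis θ r φ μ) :
    Submodule.span ℂ (Set.range φ) = quasiPeriodic θ r :=
  h.span_eq.trans (span_fvec hr)

theorem IsEigenbasis.mem_quasiPeriodic {θ : ZMod n → ZMod 2} {r : ℕ} (hr : r < mult θ)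
    {φ : Fin (period θ) → ZMod n → ℂ} {μ : Fin (period θ) → ℂ} (h : IsEigenbasis θ r φ μ)
    (j : Fin (period θ)) : φ j ∈ quasiPeriodic θ r := by
  rw [← h.span_eq_quasiPeriodic hr]
  exact Submodule.subset_span ⟨j, rfl⟩

/-- The eigenvalues of an operator in a basis of eigenvectors are the roots of the characteristic
polynomial. -/
theorem roots_charpoly_of_eigenbasis {ι V : Type*} [Fintype ι] [AddCommGroup V] [Module ℂ V]
    [Module.Finite ℂ V] (T : V →ₗ[ℂ] V) (b : Module.Basis ι ℂ V) (μ : ι → ℂ)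
    (h : ∀ i, T (b i) = μ i • b i) : T.charpoly.roots = Finset.univ.val.map μ := by
  have hT : LinearMap.toMatrix b b T = Matrix.diagonal μ := by
    ext i j
    rw [LinearMap.toMatrix_apply, h, map_smul, Module.Basis.repr_self, Finsupp.smul_single,
      smul_eq_mul, mul_one, Finsupp.single_apply, Matrix.diagonal_apply]
    by_cases hij : i = j
    · simp [hij]
    · simp [hij, Ne.symm hij]
  rw [← LinearMap.charpoly_toMatrix T b, hT, Matrix.charpoly_diagonal,
    ← Polynomial.roots_multiset_prod_X_sub_C (Finset.univ.val.map μ), Multiset.map_map]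
  rfl

/-- Both sides are the roots of the characteristic polynomial of `M_θ` restricted to the
quasi-periodic functions, which does not depend on the basis. -/
theorem IsEigenbasis.map_eq {θ : ZMod n → ZMod 2} (hn : 3 ≤ n) {r : ℕ} (hr : r < mult θ)
    {φ φ' : Fin (period θ) → ZMod n → ℂ} {μ μ' : Fin (period θ) → ℂ}
    (h : IsEigenbasis θ r φ μ) (h' : IsEigenbasis θ r φ' μ') :
    Finset.univ.val.map μ = Finset.univ.val.map μ' := by
  have hmaps : quasiPeriodic θ r ≤ (quasiPeriodic θ r).comap (thetaMap hn θ) := by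
    rw [← h.span_eq_quasiPeriodic hr, Submodule.span_le]
    rintro _ ⟨j, rfl⟩
    change thetaOp θ (φ j) ∈ Submodule.span ℂ (Set.range φ)
    rw [h.eigen j]
    exact Submodule.smul_mem _ _ (Submodule.subset_span ⟨j, rfl⟩)
  have key : ∀ {φ : Fin (period θ) → ZMod n → ℂ} {μ : Fin (period θ) → ℂ},
      IsEigenbasis θ r φ μ →
      ((thetaMap hn θ).restrict hmaps).charpoly.roots = Finset.univ.val.map μ := by
    intro φ μ h
    let v : Fin (period θ) → quasiPeriodic θ r := fun j => ⟨φ j, h.mem_quasiPeriodic hr j⟩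
    have hv : LinearIndependent ℂ v :=
      LinearIndependent.of_comp (quasiPeriodic θ r).subtype h.linearIndependent
    have hspan : ⊤ ≤ Submodule.span ℂ (Set.range v) := by
      rintro ⟨f, hf⟩ -
      have hf' := hf
      rw [← h.span_eq_quasiPeriodic hr, Submodule.mem_span_range_iff_exists_fun] at hf'
      obtain ⟨c, hc⟩ := hf'
      refine (Submodule.mem_span_range_iff_exists_fun ℂ).mpr ⟨c, Subtype.ext ?_⟩
      simp [v, hc]
    refine roots_charpoly_of_eigenbasis _ (Module.Basis.mk hv hspan) μ fun j => ?_
    rw [Module.Basis.mk_apply]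
    exact Subtype.ext (h.eigen j)
  rw [← key h, key h']

/-- The spanning condition comes from counting: `t` independent vectors lie in a space spanned by
`t` vectors. -/
theorem exists_isEigenbasis {θ : ZMod n → ZMod 2} {r : ℕ} (hr : r < mult θ) {ι : Type*}
    [Fintype ι] (hcard : Fintype.card ι = period θ) (v : ι → ZMod n → ℂ) (ν : ι → ℂ)
    (h0 : ∀ i, v i ≠ 0) (horth : ∀ i j, i ≠ j → scalarProd (v i) (v j) = 0)
    (hmem : ∀ i, v i ∈ quasiPeriodic θ r) (heigen : ∀ i, thetaOp θ (v i) = ν i • v i) :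
    ∃ φ μ, IsEigenbasis θ r φ μ ∧ Finset.univ.val.map μ = Finset.univ.val.map ν := by
  let ε : Fin (period θ) ≃ ι := (Fintype.equivFinOfCardEq hcard).symm
  refine ⟨v ∘ ε, ν ∘ ε, ⟨fun j => h0 _, fun i j hij => horth _ _ (ε.injective.ne hij), ?_,
    fun j => heigen _⟩, ?_⟩
  · rw [ε.surjective.range_comp, span_fvec hr]
    refine Submodule.eq_of_le_of_finrank_le ?_ ?_
    · rw [Submodule.span_le]
      rintro _ ⟨i, rfl⟩
      exact hmem i
    · rw [finrank_span_eq_card (linearIndependent_of_orthogonal h0 horth), hcard, ← span_fvec hr]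
      exact (finrank_range_le_card _).trans_eq (Fintype.card_fin _)
  · rw [← Multiset.map_map, Multiset.map_univ_val_equiv]

/-! ### The action of `M_θ` on the bumps -/

theorem bump_add (θ : ZMod n → ZMod 2) (r : ℕ) (s x u : ZMod n) :
    bump θ r s (x + u) = bump θ r (s - u) x := by
  unfold bump
  rw [show x + u - s = x - (s - u) by ring, show s - (x + u) = s - u - x by ring]

/-- The bump lives on `s + ⟨t⟩`, where `θ(x + c)` is constant, so the label can be read at the
centre. -/
theorem bump_congr {θ : ZMod n → ZMod 2} {r : ℕ} {s x : ZMod n} (c : ZMod n) :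
    (if θ (x + c) = 0 then bump θ r s x else 0) =
      if θ (s + c) = 0 then bump θ r s x else 0 := by
  by_cases h : x - s ∈ perSub θ
  · rw [show x + c = s + c + (x - s) by ring, add_mem_perSub θ h]
  · simp [bump, h]

/-- The bumps move like vertices: `M_θ` sends the one at `s` to half the sum of those at the
neighbours joined to `s` by an edge with label 0. -/
theorem thetaOp_bump (hn : 3 ≤ n) (θ : ZMod n → ZMod 2) (r : ℕ) (s : ZMod n) :
    thetaOp θ (bump θ r s) = (1 / 2 : ℂ) •
      ((if θ s = 0 then bump θ r (s + 1) else 0) +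
        if θ (s - 1) = 0 then bump θ r (s - 1) else 0) := by
  funext x
  have h1 := bump_congr (θ := θ) (r := r) (s := s - 1) (x := x) 0
  have h2 := bump_congr (θ := θ) (r := r) (s := s + 1) (x := x) (-1)
  simp only [add_zero] at h1
  simp only [← sub_eq_add_neg, add_sub_cancel_right] at h2
  rw [thetaOp_apply hn, bump_add, sub_eq_add_neg x 1, bump_add, sub_neg_eq_add,
    ← sub_eq_add_neg, h1, h2, Pi.smul_apply, Pi.add_apply, smul_eq_mul, add_comm]
  split_ifs <;> simp

/-! ### The paths -/

theorem pathLength_spec {θ : ZMod n → ZMod 2} (hθ : θ ≠ 0) (a : ZMod n) :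
    0 < pathLength θ a ∧ θ (a + (pathLength θ a : ZMod n) - 1) = 1 := by
  refine Nat.sInf_mem (s := {l : ℕ | 0 < l ∧ θ (a + (l : ZMod n) - 1) = 1}) ?_
  obtain ⟨k, hk⟩ := Function.ne_iff.mp hθ
  -- The summand `n` changes no residue and makes the witness positive even if `k = a - 1`.
  refine ⟨(k - a + 1).val + n, Nat.add_pos_right _ (Nat.pos_of_ne_zero (NeZero.ne n)), ?_⟩
  rw [Nat.cast_add, ZMod.natCast_zmod_val, ZMod.natCast_self,
    show a + (k - a + 1 + 0) - 1 = k by ring]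
  exact (zmod_two_eq_zero_or_one _).resolve_left hk

/-- Walk back `i` steps from two points that agree modulo `t`. The first walk reaches the start `a`,
so its left edge has label 1; if `i < i'`, the second is still strictly inside its path, where that
label is 0. -/
theorem eq_of_sub_mem_perSub_of_lt_pathLength {θ : ZMod n → ZMod 2} {a a' : ZMod n} {i i' : ℕ}
    (ha : θ (a - 1) = 1) (ha' : θ (a' - 1) = 1) (hi : i < pathLength θ a)
    (hi' : i' < pathLength θ a') (h : a + i - (a' + i') ∈ perSub θ) : i = i' := by
  wlog hii : i ≤ i' generalizing a a' i i'
  · exact (this ha' ha hi' hi (by rw [← neg_sub]; exact neg_mem h) (by omega)).symm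
  by_contra hne
  have h0 := eq_zero_of_lt_pathLength (d := i' - i) (by omega) (lt_of_le_of_lt (by omega) hi')
  rw [← add_mem_perSub θ h, Nat.cast_sub hii,
    show a' + ((i' : ZMod n) - i) - 1 + (a + i - (a' + i')) = a - 1 by ring, ha] at h0
  exact one_ne_zero h0

/-- Walk left from `x` to the first edge with label 1 and reduce the vertex to its right modulo `t`.
-/
theorem exists_start {θ : ZMod n → ZMod 2} (hθ : θ ≠ 0) (x : ZMod n) :
    ∃ a ∈ starts θ, ∃ i < pathLength θ (a : ZMod n), (a : ZMod n) + i - x ∈ perSub θ := by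
  have hex : ∃ i : ℕ, θ (x - i - 1) = 1 := by
    obtain ⟨k, hk⟩ := Function.ne_iff.mp hθ
    refine ⟨(x - 1 - k).val, ?_⟩
    rw [ZMod.natCast_zmod_val, show x - (x - 1 - k) - 1 = k by ring]
    exact (zmod_two_eq_zero_or_one _).resolve_left hk
  obtain ⟨a, ha⟩ := exists_sub_mem_perSub θ (x - (Nat.find hex : ℕ))
  have hθa : ∀ c, θ (((a : ℕ) : ZMod n) + c) = θ (x - (Nat.find hex : ℕ) + c) := fun c => by
    rw [← add_mem_perSub θ ha]
    congr 1
    ring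
  refine ⟨a, ?_, Nat.find hex, ?_, ?_⟩
  · rw [starts, Finset.mem_filter, Finset.mem_range]
    refine ⟨a.2, ?_⟩
    rw [sub_eq_add_neg, hθa, ← sub_eq_add_neg]
    exact Nat.find_spec hex
  · by_contra hlt
    rw [not_lt] at hlt
    obtain ⟨hpos, h1⟩ := pathLength_spec hθ ((a : ℕ) : ZMod n)
    rw [add_sub_assoc, hθa] at h1
    -- If the path ended before reaching `x`, its final edge with label 1 would have been met
    -- earlier on the walk to the left.
    refine Nat.find_min hex
      (m := Nat.find hex - pathLength θ ((a : ℕ) : ZMod n)) (by omega) ?_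
    rw [Nat.cast_sub hlt]
    convert h1 using 2
    ring
  · rw [← neg_sub, show x - (((a : ℕ) : ZMod n) + (Nat.find hex : ℕ)) =
      x - (Nat.find hex : ℕ) - ((a : ℕ) : ZMod n) by ring]
    exact neg_mem ha

theorem pathIndex_ext {θ : ZMod n → ZMod 2} {a a' : starts θ} {i i' : ℕ}
    (hi : i < pathLength θ ((a : ℕ) : ZMod n)) (hi' : i' < pathLength θ ((a' : ℕ) : ZMod n))
    (h : ((a : ℕ) : ZMod n) + i - (((a' : ℕ) : ZMod n) + i') ∈ perSub θ) : a = a' ∧ i = i' := by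
  obtain rfl := eq_of_sub_mem_perSub_of_lt_pathLength (starts_spec a).2 (starts_spec a').2 hi hi' h
  rw [add_sub_add_right_eq_sub] at h
  exact ⟨Subtype.ext (eq_of_sub_mem_perSub (starts_spec a).1 (starts_spec a').1 h), rfl⟩

/-- The paths starting in `0, …, t - 1` partition the residues modulo `t`. -/
theorem card_pathIndex {θ : ZMod n → ZMod 2} (hθ : θ ≠ 0) :
    Fintype.card (PathIndex θ) = period θ := by
  choose f hf using fun p : PathIndex θ =>
    exists_sub_mem_perSub θ (((p.1 : ℕ) : ZMod n) + ((p.2 : ℕ) : ZMod n))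
  rw [← Fintype.card_fin (period θ)]
  refine Fintype.card_of_bijective (f := f) ⟨?_, fun s => ?_⟩
  · rintro ⟨a, i⟩ ⟨a', i'⟩ h
    have h1 := hf ⟨a, i⟩
    rw [h] at h1
    have h2 := sub_mem h1 (hf ⟨a', i'⟩)
    rw [sub_sub_sub_cancel_right] at h2
    obtain ⟨rfl, h3⟩ := pathIndex_ext i.2 i'.2 h2
    rw [Fin.ext h3]
  · obtain ⟨a, ha, i, hi, h⟩ := exists_start hθ ((s : ℕ) : ZMod n)
    refine ⟨⟨⟨a, ha⟩, ⟨i, hi⟩⟩, ?_⟩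
    have h2 := sub_mem h (hf ⟨⟨a, ha⟩, ⟨i, hi⟩⟩)
    rw [sub_sub_sub_cancel_left] at h2
    exact Fin.ext (eq_of_sub_mem_perSub (Fin.is_lt _) s.2 h2)

/-! ### The eigenvectors of the paths -/

/-- The function on the circle with value `sin ((i + 1) x)` at the vertex `a + i` of the path of
length `l` that starts at `a`, continued to the translates of that path. -/
noncomputable def pathVec (θ : ZMod n → ZMod 2) (r : ℕ) (a : ZMod n) (l : ℕ) (x : ℝ) :
    ZMod n → ℂ :=
  ∑ i ∈ Finset.range l, ((Real.sin ((i + 1 : ℕ) * x) : ℝ) : ℂ) • bump θ r (a + i)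

theorem pathAngle_mem {l i : ℕ} (hi : i < l) : pathAngle l i ∈ Set.Ioo 0 Real.pi := by
  have hl : (0 : ℝ) < l + 1 := by positivity
  have hi' : ((i + 1 : ℕ) : ℝ) < l + 1 := by exact_mod_cast Nat.succ_lt_succ hi
  refine ⟨by unfold pathAngle; positivity, ?_⟩
  rw [pathAngle, div_lt_iff₀ hl, mul_comm]
  exact mul_lt_mul_of_pos_left hi' Real.pi_pos

theorem cos_pathAngle_injective {l i i' : ℕ} (hi : i < l) (hi' : i' < l)
    (h : Real.cos (pathAngle l i) = Real.cos (pathAngle l i')) : i = i' := by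
  have h1 := Real.injOn_cos (Set.Ioo_subset_Icc_self (pathAngle_mem hi))
    (Set.Ioo_subset_Icc_self (pathAngle_mem hi')) h
  have hl : (l + 1 : ℝ) ≠ 0 := by positivity
  unfold pathAngle at h1
  field_simp at h1
  exact_mod_cast add_right_cancel (by exact_mod_cast h1 : i + 1 = i' + 1)

theorem pathVec_mem_quasiPeriodic (θ : ZMod n → ZMod 2) (r : ℕ) (a : ZMod n) (l : ℕ) (x : ℝ) :
    pathVec θ r a l x ∈ quasiPeriodic θ r :=
  sum_mem fun _ _ => Submodule.smul_mem _ _ (bump_mem_quasiPeriodic _ _ _)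

theorem exists_of_pathVec_ne_zero {θ : ZMod n → ZMod 2} {r : ℕ} {a : ZMod n} {l : ℕ} {x : ℝ}
    {k : ZMod n} (h : pathVec θ r a l x k ≠ 0) : ∃ i < l, k - (a + i) ∈ perSub θ := by
  rw [pathVec, Finset.sum_apply] at h
  obtain ⟨i, hi, h⟩ := Finset.exists_ne_zero_of_sum_ne_zero h
  refine ⟨i, Finset.mem_range.mp hi, ?_⟩
  by_contra hk
  exact h (by simp [bump, hk])

/-- At the start `a` only the first bump is non-zero, so the value there is `sin x`. -/
theorem pathVec_ne_zero {θ : ZMod n → ZMod 2} (hθ : θ ≠ 0) (r : ℕ) {a : ZMod n}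
    (ha : θ (a - 1) = 1) {x : ℝ} (hx : x ∈ Set.Ioo 0 Real.pi) :
    pathVec θ r a (pathLength θ a) x ≠ 0 := by
  have hpos := (pathLength_spec hθ a).1
  refine Function.ne_iff.mpr ⟨a, ?_⟩
  rw [pathVec, Finset.sum_apply, Finset.sum_eq_single_of_mem 0 (Finset.mem_range.mpr hpos)]
  · have hsin := (Real.sin_pos_of_mem_Ioo hx).ne'
    have h1 : bump θ r (a + (0 : ℕ)) a = 1 := by simp [bump, zero_mem, e_zero]
    rw [Pi.smul_apply, h1, smul_eq_mul, mul_one, zero_add, Nat.cast_one, one_mul]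
    exact Complex.ofReal_ne_zero.mpr hsin
  · intro i hi hi0
    rw [Pi.smul_apply, bump, if_neg, smul_zero]
    intro h
    refine hi0 (eq_of_sub_mem_perSub_of_lt_pathLength ha ha hpos (Finset.mem_range.mp hi) ?_).symm
    simpa using h

/-- This is the recurrence `sin(ix) + sin((i+2)x) = 2 cos x sin((i+1)x)`. The terms it needs just
outside the path vanish: `sin 0` on the left, and `hx` on the right. -/
theorem thetaOp_pathVec (hn : 3 ≤ n) {θ : ZMod n → ZMod 2} (hθ : θ ≠ 0) (r : ℕ) {a : ZMod n}
    (ha : θ (a - 1) = 1) {x : ℝ} (hx : Real.sin ((pathLength θ a + 1 : ℕ) * x) = 0) :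
    thetaOp θ (pathVec θ r a (pathLength θ a) x) =
      ((Real.cos x : ℝ) : ℂ) • pathVec θ r a (pathLength θ a) x := by
  obtain ⟨hpos, hend⟩ := pathLength_spec hθ a
  have hlt := fun d => eq_zero_of_lt_pathLength (θ := θ) (a := a) (d := d)
  obtain ⟨m, hm⟩ := Nat.exists_eq_succ_of_ne_zero hpos.ne'
  rw [hm] at hx hend hlt ⊢
  set S : ℕ → ℂ := fun i => ((Real.sin (i * x) : ℝ) : ℂ) with hS
  have hS0 : S 0 = 0 := by simp [hS]
  have hSm : S (m + 2) = 0 := by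
    simp only [hS]
    exact_mod_cast hx
  have hrec : ∀ i, S i + S (i + 2) = 2 * ((Real.cos x : ℝ) : ℂ) * S (i + 1) := by
    intro i
    have h : Real.sin (i * x) + Real.sin ((i + 2 : ℕ) * x) =
        2 * Real.cos x * Real.sin ((i + 1 : ℕ) * x) := by
      have h1 : (i : ℝ) * x = (i + 1 : ℕ) * x - x := by push_cast; ring
      have h2 : ((i + 2 : ℕ) : ℝ) * x = (i + 1 : ℕ) * x + x := by push_cast; ring
      rw [h1, h2, Real.sin_sub, Real.sin_add]
      ring
    simp only [hS]
    exact_mod_cast h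
  have h1 : ∑ i ∈ Finset.range (m + 1),
      S (i + 1) • (if θ (a + i) = 0 then bump θ r (a + i + 1) else 0) =
      ∑ i ∈ Finset.range (m + 1), S i • bump θ r (a + i) := by
    -- The last term on the left is killed by the deleted edge at the end of the path, the first one
    -- on the right by `S 0 = 0`.
    rw [Finset.sum_range_succ, Finset.sum_range_succ', hS0, zero_smul, if_neg, smul_zero]
    · congr 1
      refine Finset.sum_congr rfl fun i hi => ?_
      have h := hlt (i + 1) (Nat.succ_pos i) (Nat.succ_lt_succ (Finset.mem_range.mp hi))
      rw [Nat.cast_succ, ← add_assoc, add_sub_cancel_right] at h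
      rw [if_pos h, Nat.cast_succ, add_assoc]
    · rw [Nat.succ_eq_add_one, Nat.cast_succ, ← add_assoc, add_sub_cancel_right] at hend
      rw [hend]
      exact one_ne_zero
  have h2 : ∑ i ∈ Finset.range (m + 1),
      S (i + 1) • (if θ (a + i - 1) = 0 then bump θ r (a + i - 1) else 0) =
      ∑ i ∈ Finset.range (m + 1), S (i + 2) • bump θ r (a + i) := by
    -- Mirror image: the deleted edge before `a` kills the first term on the left, `S (m + 2) = 0`
    -- the last one on the right.
    rw [Finset.sum_range_succ', Finset.sum_range_succ, hSm, zero_smul, Nat.cast_zero, add_zero a,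
      if_neg (by rw [ha]; exact one_ne_zero), smul_zero]
    congr 1
    refine Finset.sum_congr rfl fun i hi => ?_
    have h := hlt (i + 1) (Nat.succ_pos i) (Nat.succ_lt_succ (Finset.mem_range.mp hi))
    rw [if_pos h, Nat.cast_succ, ← add_assoc, add_sub_cancel_right]
  change thetaMap hn θ (∑ i ∈ Finset.range (m + 1), S (i + 1) • bump θ r (a + i)) =
    _ • ∑ i ∈ Finset.range (m + 1), S (i + 1) • bump θ r (a + i)
  have h3 : ∀ i : ℕ, thetaMap hn θ (S (i + 1) • bump θ r (a + i)) = (1 / 2 : ℂ) •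
      (S (i + 1) • (if θ (a + i) = 0 then bump θ r (a + i + 1) else 0) +
        S (i + 1) • (if θ (a + i - 1) = 0 then bump θ r (a + i - 1) else 0)) := by
    intro i
    rw [map_smul, ← smul_add, smul_comm (1 / 2 : ℂ)]
    congr 1
    exact thetaOp_bump hn θ r _
  rw [map_sum, Finset.sum_congr rfl fun i _ => h3 i, ← Finset.smul_sum, Finset.sum_add_distrib,
    h1, h2, ← Finset.sum_add_distrib, Finset.smul_sum, Finset.smul_sum]
  refine Finset.sum_congr rfl fun i _ => ?_
  rw [← add_smul, hrec, smul_smul, smul_smul]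
  congr 1
  ring

theorem scalarProd_eq_zero_of_eigen (hn : 3 ≤ n) {θ : ZMod n → ZMod 2} {f g : ZMod n → ℂ}
    {c d : ℝ} (hcd : c ≠ d) (hf : thetaOp θ f = (c : ℂ) • f) (hg : thetaOp θ g = (d : ℂ) • g) :
    scalarProd f g = 0 := by
  have h := scalarProd_thetaOp hn θ f g
  rw [hf, hg, scalarProd_smul_left, scalarProd_smul_right, Complex.conj_ofReal, ← sub_eq_zero,
    ← sub_mul, ← Complex.ofReal_sub] at h
  exact (mul_eq_zero.mp h).resolve_left (Complex.ofReal_ne_zero.mpr (sub_ne_zero.mpr hcd))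

theorem period_zero : period (0 : ZMod n → ZMod 2) = 1 :=
  Nat.dvd_one.mp (period_dvd_of_forall fun _ => rfl)

/-- Here `⟨t⟩` is the whole circle and the bump is a character, so `M_θ` multiplies it by the mean
of `exp(±2πir/n)`. -/
theorem thetaOp_zero_bump (hn : 3 ≤ n) (r : ℕ) :
    thetaOp 0 (bump (0 : ZMod n → ZMod 2) r 0) =
      ((Real.cos (2 * Real.pi * r / n) : ℝ) : ℂ) • bump (0 : ZMod n → ZMod 2) r 0 := by
  have hmem : ∀ h : ZMod n, h ∈ perSub (0 : ZMod n → ZMod 2) := fun h =>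
    mem_perSub_of_forall fun _ => rfl
  have hbump : ∀ s k : ZMod n, bump (0 : ZMod n → ZMod 2) r s k = e r (s - k) := fun s k =>
    if_pos (hmem _)
  have hexp : ∀ z : ℤ, e r (z : ZMod n) =
      Complex.exp (((2 * Real.pi * r / n : ℝ) : ℂ) * z * Complex.I) := by
    intro z
    rw [e, show ((r : ZMod n) * (z : ZMod n)) = (((r : ℤ) * z : ℤ) : ZMod n) by push_cast; rfl,
      ZMod.stdAddChar_coe]
    congr 1
    push_cast
    ring
  have h1 := hexp 1
  have h2 := hexp (-1)
  push_cast at h1 h2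
  funext x
  rw [thetaOp_bump hn, Pi.smul_apply, Pi.smul_apply, Pi.add_apply,
    if_pos (Pi.zero_apply _), if_pos (Pi.zero_apply _), hbump,
    hbump, hbump, show (0 : ZMod n) + 1 - x = 1 + (0 - x) by ring,
    show (0 : ZMod n) - 1 - x = -1 + (0 - x) by ring, e_add, e_add, h1, h2, Complex.ofReal_cos,
    Complex.cos, smul_eq_mul, smul_eq_mul]
  push_cast
  simp only [mul_one, mul_neg]
  ring

theorem exists_isEigenbasis_thetaSpectrum (hn : 3 ≤ n) {θ : ZMod n → ZMod 2} {r : ℕ}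
    (hr : r < mult θ) : ∃ φ μ, IsEigenbasis θ r φ μ ∧
      Finset.univ.val.map μ = (thetaSpectrum θ r).map (fun x : ℝ => (x : ℂ)) := by
  by_cases hθ : θ = 0
  · subst hθ
    obtain ⟨φ, μ, h, hμ⟩ := exists_isEigenbasis hr (ι := Unit) (by simp [period_zero])
      (fun _ => bump 0 r 0) (fun _ => ((Real.cos (2 * Real.pi * r / n) : ℝ) : ℂ))
      (fun _ => Function.ne_iff.mpr ⟨0, by simp [bump, zero_mem, e_zero]⟩)
      (fun _ _ h => absurd rfl h) (fun _ => bump_mem_quasiPeriodic _ _ _)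
      (fun _ => thetaOp_zero_bump hn r)
    refine ⟨φ, μ, h, hμ.trans ?_⟩
    rw [thetaSpectrum, if_pos rfl]
    rfl
  · have hsin : ∀ l i : ℕ, Real.sin ((l + 1 : ℕ) * pathAngle l i) = 0 := by
      intro l i
      have hl : (l + 1 : ℝ) ≠ 0 := by positivity
      rw [pathAngle, Nat.cast_succ l, mul_div_cancel₀ _ hl, Real.sin_nat_mul_pi]
    have heigen := fun p : PathIndex θ =>
      thetaOp_pathVec hn hθ r (starts_spec p.1).2 (hsin (pathLength θ ((p.1 : ℕ) : ZMod n)) p.2)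
    rw [map_thetaSpectrum hθ]
    refine exists_isEigenbasis hr (card_pathIndex hθ)
      (fun p : PathIndex θ => pathVec θ r ((p.1 : ℕ) : ZMod n) (pathLength θ ((p.1 : ℕ) : ZMod n))
        (pathAngle (pathLength θ ((p.1 : ℕ) : ZMod n)) p.2)) _
      (fun p => pathVec_ne_zero hθ r (starts_spec p.1).2 (pathAngle_mem p.2.2)) ?_
      (fun p => pathVec_mem_quasiPeriodic _ _ _ _ _) heigen
    rintro ⟨a, i⟩ ⟨a', i'⟩ hne
    -- On one path the eigenvalues are distinct and self-adjointness applies; different paths give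
    -- disjoint supports.
    by_cases haa : a = a'
    · subst haa
      refine scalarProd_eq_zero_of_eigen hn (fun h => hne ?_) (heigen ⟨a, i⟩) (heigen ⟨a, i'⟩)
      rw [Fin.ext (cos_pathAngle_injective i.2 i'.2 h)]
    · refine Finset.sum_eq_zero fun k _ => ?_
      by_contra hk
      obtain ⟨j, hj, h⟩ := exists_of_pathVec_ne_zero (left_ne_zero_of_mul hk)
      obtain ⟨j', hj', h'⟩ := exists_of_pathVec_ne_zero
        ((map_ne_zero _).mp (right_ne_zero_of_mul hk))
      have h2 := sub_mem h' h
      rw [sub_sub_sub_cancel_left] at h2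
      exact haa (pathIndex_ext hj hj' h2).1

end

section

/-! ### Maps out of an induced representation -/

section induced

open Representation

/-- The existence half of Frobenius reciprocity. The inverse appears because `IndV.mk φ ρ h a` is
the image of `IndV.mk φ ρ 1 a` under `h⁻¹`. -/
theorem ind_exists_intertwiningMap {G H A B : Type*} [Group G] [Group H] [AddCommGroup A]
    [Module ℂ A] [AddCommGroup B] [Module ℂ B] (φ : G →* H) (ρ : Representation ℂ G A)
    (τ : Representation ℂ H B) (f : A →ₗ[ℂ] B) (hf : ∀ g a, f (ρ g a) = τ (φ g) (f a)) :
    ∃ F : (ind φ ρ).IntertwiningMap τ, ∀ h a, F (IndV.mk φ ρ h a) = τ h⁻¹ (f a) := by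
  refine ⟨⟨Coinvariants.lift _
    (TensorProduct.lift ((Finsupp.lift _ _ _ fun h => τ h⁻¹ ∘ₗ f) ∘ₗ
      (MonoidAlgebra.coeffLinearEquiv ℂ).toLinearMap)) fun g => ?_, fun g => ?_⟩, fun h a => ?_⟩
  · ext h x
    simp [ofMulAction_single, mul_inv_rev, hf]
  · ext
    simp
  · rw [← Representation.IntertwiningMap.toLinearMap_apply]
    simp

variable {G H : Type*} [Group G] [Group H] (φ : G →* H) (ψ : G →* ℂ)

theorem charRep_apply (g : G) (a : ℂ) : charRep ψ g a = ψ g * a := rfl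

theorem indMk_mul (g : G) (h : H) :
    IndV.mk φ (charRep ψ) (φ g * h) (ψ g) = IndV.mk φ (charRep ψ) h 1 := by
  have := Coinvariants.mk_self_apply (Representation.tprod ((leftRegular ℂ H).comp φ) (charRep ψ)) g
    (TensorProduct.tmul ℂ (MonoidAlgebra.single h 1) 1)
  simpa [charRep_apply, ofMulAction_single] using this

theorem indMk_eq_smul (h : H) (a : ℂ) :
    IndV.mk φ (charRep ψ) h a = a • IndV.mk φ (charRep ψ) h 1 := by
  rw [← map_smul, smul_eq_mul, mul_one]

theorem ind_apply_one (g : G) : ind φ (charRep ψ) (φ g) (IndV.mk φ (charRep ψ) 1 1) =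
    ψ g • IndV.mk φ (charRep ψ) 1 1 := by
  rw [ind_mk, one_mul, ← indMk_eq_smul, ← indMk_mul φ ψ g, mul_inv_cancel]

theorem indV_span :
    Submodule.span ℂ (Set.range fun h : H => IndV.mk φ (charRep ψ) h 1) = ⊤ := by
  rw [eq_top_iff, ← Submodule.ker_mkQ (Submodule.span ℂ _)]
  rintro v -
  have : (Submodule.span ℂ (Set.range fun h : H => IndV.mk φ (charRep ψ) h 1)).mkQ = 0 := by
    refine IndV.hom_ext φ _ fun h => LinearMap.ext fun a => ?_
    rw [LinearMap.comp_apply, indMk_eq_smul, map_smul]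
    simp only [LinearMap.zero_comp, LinearMap.zero_apply]
    refine smul_eq_zero_of_right _ ((Submodule.Quotient.mk_eq_zero _).mpr ?_)
    exact Submodule.subset_span ⟨h, rfl⟩
  rw [this]
  rfl

end induced

variable {n : ℕ} [NeZero n]

/-! ### The pieces -/

/-- The generator `χ_{sθ} ⊗ sφ` of a piece. -/
noncomputable def pieceGen (θ : ZMod n → ZMod 2) (φ : ZMod n → ℂ) (s : ZMod n) : Wreath n → ℂ :=
  tens (chi (translate s θ)) (translate s φ)

theorem piece_eq_span (θ : ZMod n → ZMod 2) (φ : ZMod n → ℂ) : piece θ φ =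
    Submodule.span ℂ (Set.range fun s : Fin (period θ) => pieceGen θ φ ((s : ℕ) : ZMod n)) := rfl

theorem pieceGen_zero (θ : ZMod n → ZMod 2) (φ : ZMod n → ℂ) :
    pieceGen θ φ 0 = tens (chi θ) φ := by
  rw [pieceGen, translate_zero, translate_zero]

theorem regRep_pieceGen (θ : ZMod n → ZMod 2) (φ : ZMod n → ℂ) (g : Wreath n) (s : ZMod n) :
    regRep (Wreath n) g (pieceGen θ φ s) =
      chi (translate (pos g + s) θ) (lamps g) • pieceGen θ φ (pos g + s) := by
  rw [pieceGen, regRep_tens, translate_translate, translate_translate, pieceGen]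

theorem regRep_wr_pieceGen (θ : ZMod n → ZMod 2) (φ : ZMod n → ℂ) (u s : ZMod n) :
    regRep (Wreath n) (wr 0 u) (pieceGen θ φ s) = pieceGen θ φ (u + s) := by
  rw [regRep_pieceGen, lamps_wr, chi_zero, one_smul, pos_wr]

theorem pieceGen_add_perSub {θ : ZMod n → ZMod 2} {r : ℕ} {φ : ZMod n → ℂ}
    (hφ : φ ∈ quasiPeriodic θ r) (s : ZMod n) {h : ZMod n} (hh : h ∈ perSub θ) :
    pieceGen θ φ (s + h) = e r h • pieceGen θ φ s := by
  rw [pieceGen, ← translate_translate, ← translate_translate s h φ, translate_perSub hh,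
    translate_quasiPeriodic hφ hh, pieceGen, ← tens_smul]
  rfl

theorem pieceGen_mem {θ : ZMod n → ZMod 2} {r : ℕ} {φ : ZMod n → ℂ}
    (hφ : φ ∈ quasiPeriodic θ r) (u : ZMod n) : pieceGen θ φ u ∈ piece θ φ := by
  obtain ⟨i, hi⟩ := exists_sub_mem_perSub θ u
  rw [← add_sub_cancel ((i : ℕ) : ZMod n) u, pieceGen_add_perSub hφ _ hi]
  exact Submodule.smul_mem _ _ (Submodule.subset_span ⟨i, rfl⟩)

theorem regRep_mem_piece {θ : ZMod n → ZMod 2} {r : ℕ} {φ : ZMod n → ℂ}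
    (hφ : φ ∈ quasiPeriodic θ r) (g : Wreath n) {F : Wreath n → ℂ} (hF : F ∈ piece θ φ) :
    regRep (Wreath n) g F ∈ piece θ φ := by
  have : piece θ φ ≤ (piece θ φ).comap (regRep (Wreath n) g) := by
    refine Submodule.span_le.mpr ?_
    rintro _ ⟨s, rfl⟩
    change regRep (Wreath n) g (pieceGen θ φ _) ∈ piece θ φ
    rw [regRep_pieceGen]
    exact Submodule.smul_mem _ _ (pieceGen_mem hφ _)
  exact this hF

/-- The piece of a quasi-periodic function, as a subrepresentation. -/
noncomputable def pieceRep {θ : ZMod n → ZMod 2} {r : ℕ} {φ : ZMod n → ℂ}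
    (hφ : φ ∈ quasiPeriodic θ r) : Subrepresentation (regRep (Wreath n)) where
  toSubmodule := piece θ φ
  apply_mem_toSubmodule g _ hF := regRep_mem_piece hφ g hF

theorem scalarProd_pieceGen_eq_zero {θ : ZMod n → ZMod 2} {φ φ' : ZMod n → ℂ}
    {s s' : Fin (period θ)} (h : s ≠ s' ∨ scalarProd φ φ' = 0) :
    scalarProd (pieceGen θ φ ((s : ℕ) : ZMod n)) (pieceGen θ φ' ((s' : ℕ) : ZMod n)) = 0 := by
  rw [pieceGen, pieceGen, scalarProd_tens]
  by_cases hs : s = s'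
  · subst hs
    rw [scalarProd_translate, h.resolve_left (not_not_intro rfl), mul_zero]
  · rw [sum_chi_mul_chi fun h => hs (Fin.ext (translate_natCast_injective s.2 s'.2 h)), zero_mul]

theorem scalarProd_piece_eq_zero {θ : ZMod n → ZMod 2} {φ φ' : ZMod n → ℂ}
    (h : scalarProd φ φ' = 0) {F F' : Wreath n → ℂ} (hF : F ∈ piece θ φ)
    (hF' : F' ∈ piece θ φ') : scalarProd F F' = 0 := by
  refine scalarProd_eq_zero_of_mem_span ?_ hF hF'
  rintro _ ⟨s, rfl⟩ _ ⟨s', rfl⟩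
  exact scalarProd_pieceGen_eq_zero (Or.inr h)

theorem linearIndependent_pieceGen (θ : ZMod n → ZMod 2) {φ : ZMod n → ℂ} (h0 : φ ≠ 0) :
    LinearIndependent ℂ fun s : Fin (period θ) => pieceGen θ φ ((s : ℕ) : ZMod n) := by
  refine linearIndependent_of_orthogonal (fun s => tens_ne_zero _ fun h => h0 ?_)
    fun s s' h => scalarProd_pieceGen_eq_zero (Or.inl h)
  rw [← translate_zero φ, ← neg_add_cancel ((s : ℕ) : ZMod n), ← translate_translate, h]
  rfl

theorem lampOp_piece (hn : 3 ≤ n) {θ : ZMod n → ZMod 2} {φ : ZMod n → ℂ} {μ : ℂ}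
    (h : thetaOp θ φ = μ • φ) {F : Wreath n → ℂ} (hF : F ∈ piece θ φ) : lampOp n F = μ • F := by
  have : piece θ φ ≤ LinearMap.ker (lampOp n - μ • LinearMap.id) := by
    refine Submodule.span_le.mpr ?_
    rintro _ ⟨s, rfl⟩
    simp only [SetLike.mem_coe, LinearMap.mem_ker, LinearMap.sub_apply, LinearMap.smul_apply,
      LinearMap.id_apply]
    rw [lampOp_tens hn, thetaOp_translate hn, h, sub_eq_zero, ← tens_smul]
    rfl
  have h := this hF
  simpa [sub_eq_zero] using h

/-! ### Irreducibility -/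

/-- Up to the order of the lamp group, this sum is the projection onto the `χ_{sθ}`-component, to
which only the `s`-th generator belongs. -/
theorem sum_chi_smul_regRep_pieceGen (θ : ZMod n → ZMod 2) (φ : ZMod n → ℂ)
    (s s' : Fin (period θ)) :
    ∑ ω, chi (translate ((s : ℕ) : ZMod n) θ) ω •
        regRep (Wreath n) (wr ω 0) (pieceGen θ φ ((s' : ℕ) : ZMod n)) =
      if s = s' then (Fintype.card (ZMod n → ZMod 2) : ℂ) • pieceGen θ φ ((s' : ℕ) : ZMod n)
      else 0 := by
  simp only [regRep_pieceGen, pos_wr, lamps_wr, zero_add, smul_smul, ← Finset.sum_smul]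
  split_ifs with h
  · rw [h, sum_chi_mul_self]
  · rw [sum_chi_mul_chi fun h' => h (Fin.ext (translate_natCast_injective s.2 s'.2 h')), zero_smul]

/-- Projecting a non-zero element on a character with non-zero coefficient puts one generator in
`N`; pure translations then carry it to all the others. -/
theorem piece_le_of_mem {θ : ZMod n → ZMod 2} {F : Wreath n → ℂ} {f : ZMod n → ℂ}
    {N : Submodule ℂ (Wreath n → ℂ)} (hN : ∀ g, ∀ F ∈ N, regRep (Wreath n) g F ∈ N)
    (hF : F ∈ piece θ f) (hFN : F ∈ N) (h0 : F ≠ 0) : piece θ f ≤ N := by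
  rw [piece_eq_span, Submodule.mem_span_range_iff_exists_fun] at hF
  obtain ⟨c, rfl⟩ := hF
  obtain ⟨s, -, hs⟩ := Finset.exists_ne_zero_of_sum_ne_zero h0
  have hproj : ∑ ω, chi (translate ((s : ℕ) : ZMod n) θ) ω • regRep (Wreath n) (wr ω 0)
      (∑ i, c i • pieceGen θ f ((i : ℕ) : ZMod n)) =
      (c s * (Fintype.card (ZMod n → ZMod 2) : ℂ)) • pieceGen θ f ((s : ℕ) : ZMod n) := by
    simp only [map_sum, map_smul, Finset.smul_sum]
    rw [Finset.sum_comm]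
    simp only [smul_comm _ (c _)]
    simp only [← Finset.smul_sum, sum_chi_smul_regRep_pieceGen]
    simp [smul_smul]
  have hmem : pieceGen θ f ((s : ℕ) : ZMod n) ∈ N := by
    refine (Submodule.smul_mem_iff N (mul_ne_zero (left_ne_zero_of_smul hs)
      (Nat.cast_ne_zero.mpr (Fintype.card_ne_zero (α := ZMod n → ZMod 2))))).mp ?_
    rw [← hproj]
    exact sum_mem fun ω _ => N.smul_mem _ (hN _ _ hFN)
  refine Submodule.span_le.mpr ?_
  rintro _ ⟨i, rfl⟩
  have h := hN (wr 0 (((i : ℕ) : ZMod n) - ((s : ℕ) : ZMod n))) _ hmem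
  rwa [regRep_wr_pieceGen, sub_add_cancel] at h

theorem isIrreducible_pieceRep {θ : ZMod n → ZMod 2} {r : ℕ} {φ : ZMod n → ℂ}
    (hφ : φ ∈ quasiPeriodic θ r) (h0 : φ ≠ 0) :
    (pieceRep hφ).toRepresentation.IsIrreducible := by
  have hgen : tens (chi θ) φ ∈ piece θ φ := by
    rw [← pieceGen_zero]
    exact pieceGen_mem hφ 0
  refine { exists_pair_ne := ⟨⊥, ⊤, fun h => tens_ne_zero θ h0 ?_⟩, eq_bot_or_eq_top := fun N => ?_ }
  · have h1 : (⟨_, hgen⟩ : (pieceRep hφ).toSubmodule) ∈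
        (⊥ : Subrepresentation (pieceRep hφ).toRepresentation) := by
      rw [h]
      exact Submodule.mem_top
    exact congrArg Subtype.val ((Submodule.mem_bot ℂ).mp h1)
  · by_cases hbot : N.toSubmodule = ⊥
    · exact Or.inl (Subrepresentation.toSubmodule_injective hbot)
    · right
      obtain ⟨F, hF, hF0⟩ := Submodule.exists_mem_ne_zero_of_ne_bot hbot
      have hle := piece_le_of_mem (N := N.toSubmodule.map (pieceRep hφ).toSubmodule.subtype)
        (by
          rintro g _ ⟨F, hF, rfl⟩
          exact ⟨_, N.apply_mem_toSubmodule g hF, rfl⟩) F.2 ⟨F, hF, rfl⟩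
        (fun h => hF0 (Subtype.ext h))
      refine Subrepresentation.toSubmodule_injective (eq_top_iff.mpr fun F' _ => ?_)
      obtain ⟨F'', hF'', h⟩ := hle F'.2
      rwa [Subtype.ext h] at hF''

/-! ### Equivalence with the induced representation -/

theorem regRep_inertia_tens {θ : ZMod n → ZMod 2} {r : ℕ} {φ : ZMod n → ℂ}
    (hφ : φ ∈ quasiPeriodic θ r) (h : inertia θ) :
    regRep (Wreath n) (h : Wreath n) (tens (chi θ) φ) =
      ((chiExt θ * eInfl θ r) h) • tens (chi θ) φ := by
  rw [regRep_tens, translate_perSub h.2, translate_quasiPeriodic hφ h.2, tens_smul, smul_smul]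
  rfl

/-- The elements `(0, -s)` represent the cosets, and the inducing character absorbs the rest. The
sign makes the `s`-th vector correspond to `χ_{sθ} ⊗ sφ`. -/
theorem indV_span_fin (θ : ZMod n → ZMod 2) (r : ℕ) :
    Submodule.span ℂ (Set.range fun s : Fin (period θ) =>
      Representation.IndV.mk (inertia θ).subtype (charRep (chiExt θ * eInfl θ r))
        (wr 0 (-((s : ℕ) : ZMod n))) 1) = ⊤ := by
  rw [eq_top_iff, ← indV_span, Submodule.span_le]
  rintro _ ⟨h, rfl⟩
  obtain ⟨i, hi⟩ := exists_sub_mem_perSub θ (-pos h)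
  let g : inertia θ := ⟨wr 0 (-((i : ℕ) : ZMod n)) * h⁻¹, by
    change -((i : ℕ) : ZMod n) + -pos h ∈ perSub θ
    rwa [neg_add_eq_sub]⟩
  have key := indMk_mul (inertia θ).subtype (chiExt θ * eInfl θ r) g h
  rw [Subgroup.coe_subtype, inv_mul_cancel_right, indMk_eq_smul] at key
  change Representation.IndV.mk (inertia θ).subtype (charRep (chiExt θ * eInfl θ r)) h 1 ∈ _
  rw [← key]
  exact Submodule.smul_mem _ _ (Submodule.subset_span ⟨i, rfl⟩)

/-- The map given by Frobenius reciprocity takes the `t` spanning vectors of `indV_span_fin` to the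
independent generators that span the piece, so it is bijective. -/
theorem nonempty_equiv_indRep {θ : ZMod n → ZMod 2} {r : ℕ} {φ : ZMod n → ℂ}
    (hφ : φ ∈ quasiPeriodic θ r) (h0 : φ ≠ 0) :
    Nonempty ((pieceRep hφ).toRepresentation.Equiv (indRep θ r)) := by
  have hgen : tens (chi θ) φ ∈ piece θ φ := by
    rw [← pieceGen_zero]
    exact pieceGen_mem hφ 0
  obtain ⟨F, hF⟩ := ind_exists_intertwiningMap (inertia θ).subtype
    (charRep (chiExt θ * eInfl θ r)) (pieceRep hφ).toRepresentation
    (LinearMap.toSpanSingleton ℂ (pieceRep hφ).toSubmodule ⟨_, hgen⟩) (fun g a => by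
      rw [LinearMap.toSpanSingleton_apply, LinearMap.toSpanSingleton_apply, map_smul,
        charRep_apply, mul_comm, mul_smul]
      congr 1
      exact Subtype.ext (regRep_inertia_tens hφ g).symm)
  have hF' : ∀ s : ZMod n, ((F (Representation.IndV.mk (inertia θ).subtype
      (charRep (chiExt θ * eInfl θ r)) (wr 0 (-s)) 1) : (pieceRep hφ).toSubmodule) :
        Wreath n → ℂ) = pieceGen θ φ s := by
    intro s
    rw [hF, LinearMap.toSpanSingleton_apply, one_smul]
    change regRep (Wreath n) (wr 0 (-s))⁻¹ (tens (chi θ) φ) = _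
    rw [← pieceGen_zero, regRep_pieceGen, pos_inv, pos_wr, lamps_inv, lamps_wr, neg_neg, add_zero]
    change chi _ 0 • _ = _
    rw [chi_zero, one_smul]
  have hbij : Function.Bijective F := by
    constructor
    · rw [← Representation.IntertwiningMap.coe_toLinearMap, injective_iff_map_eq_zero]
      intro v hv
      have hv' : v ∈ (⊤ : Submodule ℂ _) := Submodule.mem_top
      rw [← indV_span_fin, Submodule.mem_span_range_iff_exists_fun] at hv'
      obtain ⟨c, rfl⟩ := hv'
      have hsum : ∑ s : Fin (period θ), c s • pieceGen θ φ ((s : ℕ) : ZMod n) = 0 := by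
        have h1 := congrArg (pieceRep hφ).toSubmodule.subtype hv
        rw [Representation.IntertwiningMap.coe_toLinearMap] at h1
        simpa only [map_sum, map_smul, map_zero, Submodule.subtype_apply, hF'] using h1
      have hc := Fintype.linearIndependent_iff.mp (linearIndependent_pieceGen θ h0) c hsum
      simp [hc]
    · rintro ⟨f, hf⟩
      have hf' := hf
      change f ∈ piece θ φ at hf'
      rw [piece_eq_span, Submodule.mem_span_range_iff_exists_fun] at hf'
      obtain ⟨c, hc⟩ := hf'
      refine ⟨∑ s : Fin (period θ), c s • Representation.IndV.mk (inertia θ).subtype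
        (charRep (chiExt θ * eInfl θ r)) (wr 0 (-((s : ℕ) : ZMod n))) 1, Subtype.ext ?_⟩
      change (pieceRep hφ).toSubmodule.subtype _ = f
      simp only [map_sum, map_smul, Submodule.subtype_apply, hF', hc]
  exact ⟨(Representation.IntertwiningMap.ofBijective F hbij).symm⟩

/-! ### The isotypic component -/

/-- The elements `(ω, 0)` force `F(ω, x) = χ_θ(ω) F(0, x)`; the elements `(0, u)` with `u ∈ ⟨t⟩`
force quasi-periodicity of `F(0, ·)`. -/
theorem exists_tens_of_regRep_inertia {θ : ZMod n → ZMod 2} {r : ℕ} {F : Wreath n → ℂ}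
    (hF : ∀ h : inertia θ, regRep (Wreath n) (h : Wreath n) F = ((chiExt θ * eInfl θ r) h) • F) :
    ∃ f ∈ quasiPeriodic θ r, F = tens (chi θ) f := by
  have key : ∀ (h : Wreath n), pos h ∈ perSub θ → ∀ x,
      F (h⁻¹ * x) = chi θ (lamps h) * e r (pos h) * F x := fun h hh x => congrFun (hF ⟨h, hh⟩) x
  refine ⟨fun k => F (wr 0 k), fun u hu k => ?_, funext fun g => ?_⟩
  · have h := key (wr 0 u) hu (wr 0 k)
    rw [lamps_wr, chi_zero, one_mul, pos_wr] at h
    rw [← h]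
    refine congrArg F (wreath_ext ?_ ?_)
    · rw [lamps_mul, lamps_inv, lamps_wr, lamps_wr]
      exact (add_zero _).symm
    · rw [pos_mul, pos_inv, pos_wr, pos_wr, pos_wr, neg_add_eq_sub]
  · have h := key (wr (lamps g) 0) (zero_mem _) g
    have hg : (wr (lamps g) 0)⁻¹ * g = wr 0 (pos g) := by
      refine wreath_ext ?_ ?_
      · rw [lamps_mul, lamps_inv, pos_inv, pos_wr, neg_zero, translate_zero, translate_zero,
          lamps_wr, lamps_wr, CharTwo.add_self_eq_zero]
      · rw [pos_mul, pos_inv, pos_wr, pos_wr, neg_zero, zero_add]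
    rw [hg, lamps_wr, pos_wr, e_zero, mul_one] at h
    rw [tens, h, ← mul_assoc, chi_mul_self, one_mul]

/-- A copy of the induced representation is generated by the image of its cyclic vector `w`, which
transforms by the inducing character and hence has the form `χ_θ ⊗ f`. -/
theorem isotypic_le {θ : ZMod n → ZMod 2} {r : ℕ} {P : Submodule ℂ (Wreath n → ℂ)}
    (hP : ∀ g, ∀ F ∈ P, regRep (Wreath n) g F ∈ P)
    (hmem : ∀ f ∈ quasiPeriodic θ r, tens (chi θ) f ∈ P) :
    isotypic (regRep (Wreath n)) (indRep θ r) ≤ P := by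
  refine iSup₂_le fun U hU => ?_
  obtain ⟨E⟩ := hU
  let w := Representation.IndV.mk (inertia θ).subtype (charRep (chiExt θ * eInfl θ r)) 1 1
  have hE : ∀ g v, ((E.symm (indRep θ r g v) : U.toSubmodule) : Wreath n → ℂ) =
      regRep (Wreath n) g (E.symm v : U.toSubmodule) := fun g v =>
    congrArg Subtype.val (E.symm.toIntertwiningMap.isIntertwining _ _ g v)
  have hw : ((E.symm w : U.toSubmodule) : Wreath n → ℂ) ∈ P := by
    obtain ⟨f, hf, h⟩ := exists_tens_of_regRep_inertia (θ := θ) (r := r)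
      (F := (E.symm w : U.toSubmodule)) fun h => by
        rw [← hE]
        have h1 : indRep θ r (h : Wreath n) w = ((chiExt θ * eInfl θ r) h) • w :=
          ind_apply_one (inertia θ).subtype (chiExt θ * eInfl θ r) h
        rw [h1, map_smul]
        rfl
    rw [h]
    exact hmem f hf
  have hall : ∀ v, ((E.symm v : U.toSubmodule) : Wreath n → ℂ) ∈ P := by
    intro v
    have hv : v ∈ (⊤ : Submodule ℂ _) := Submodule.mem_top
    rw [← indV_span] at hv
    induction hv using Submodule.span_induction with
    | mem v hv =>
      obtain ⟨h, rfl⟩ := hv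
      have h1 : Representation.IndV.mk (inertia θ).subtype (charRep (chiExt θ * eInfl θ r)) h 1 =
          indRep θ r h⁻¹ w := by
        rw [indRep, Representation.ind_mk, one_mul, inv_inv]
      change ((E.symm (Representation.IndV.mk (inertia θ).subtype
        (charRep (chiExt θ * eInfl θ r)) h 1) : U.toSubmodule) : Wreath n → ℂ) ∈ P
      rw [h1, hE]
      exact hP _ _ hw
    | zero =>
      rw [map_zero]
      exact zero_mem _
    | add v v' _ _ h h' =>
      rw [map_add]
      exact add_mem h h'
    | smul c v _ h =>
      rw [map_smul]
      exact P.smul_mem c h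
  intro F hF
  have h := hall (E ⟨F, hF⟩)
  rwa [Representation.Equiv.symm_apply_apply] at h

end

end CircleLamp

/-! ### The decomposition of the isotypic component -/

theorem mainTheorem10 (n : ℕ) [NeZero n] (hn : 3 ≤ n) (θ : ZMod n → ZMod 2)
    (r : ℕ) (hr : r < mult θ) :
    (∃ (φ : Fin (period θ) → ZMod n → ℂ) (μ : Fin (period θ) → ℂ), IsEigenbasis θ r φ μ) ∧
    ∀ (φ : Fin (period θ) → ZMod n → ℂ) (μ : Fin (period θ) → ℂ), IsEigenbasis θ r φ μ →
      -- the eigenvalues come from the path and circle spectra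
      (Finset.univ.val.map μ = (thetaSpectrum θ r).map (fun x : ℝ => (x : ℂ))) ∧
      -- the line of `χ_θ ⊗ φ_j` affords the character that is induced
      (∀ j, ∀ h : inertia θ, regRep (Wreath n) (h : Wreath n) (tens (chi θ) (φ j)) =
        ((chiExt θ * eInfl θ r) h) • tens (chi θ) (φ j)) ∧
      ∃ U : Fin (period θ) → Subrepresentation (regRep (Wreath n)),
        (∀ j, (U j).toSubmodule = piece θ (φ j)) ∧
        (∀ j, Nonempty ((U j).toRepresentation.Equiv (indRep θ r))) ∧
        (∀ j, (U j).toRepresentation.IsIrreducible) ∧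
        -- orthogonal direct sum decomposition of the isotypic component
        (∀ i j, i ≠ j → ∀ F ∈ U i, ∀ F' ∈ U j, scalarProd F F' = 0) ∧
        iSupIndep (fun j => (U j).toSubmodule) ∧
        (⨆ j, (U j).toSubmodule) = isotypic (regRep (Wreath n)) (indRep θ r) ∧
        -- each piece is an eigenspace of the lamplighter operator
        (∀ j, ∀ F ∈ U j, lampOp n F = μ j • F) := by
  obtain ⟨φ₀, μ₀, h₀, hμ₀⟩ := exists_isEigenbasis_thetaSpectrum hn hr
  refine ⟨⟨φ₀, μ₀, h₀⟩, fun φ μ h => ?_⟩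
  have hφ := h.mem_quasiPeriodic hr
  refine ⟨(h.map_eq hn hr h₀).trans hμ₀, fun j => regRep_inertia_tens (hφ j),
    fun j => pieceRep (hφ j), fun j => rfl, fun j => nonempty_equiv_indRep (hφ j) (h.ne_zero j),
    fun j => isIrreducible_pieceRep (hφ j) (h.ne_zero j), ?_, ?_, le_antisymm ?_ ?_,
    fun j F hF => lampOp_piece hn (h.eigen j) hF⟩
  · exact fun i j hij F hF F' hF' => scalarProd_piece_eq_zero (h.orthogonal i j hij) hF hF'
  · exact iSupIndep_of_orthogonal _ fun i j hij F hF F' hF' =>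
      scalarProd_piece_eq_zero (h.orthogonal i j hij) hF hF'
  · exact iSup_le fun j => le_iSup₂_of_le (pieceRep (hφ j))
      (nonempty_equiv_indRep (hφ j) (h.ne_zero j)) le_rfl
  · refine isotypic_le (fun g => ?_) fun f hf => ?_
    · have hle : (⨆ j, (pieceRep (hφ j)).toSubmodule) ≤
          (⨆ j, (pieceRep (hφ j)).toSubmodule).comap (regRep (Wreath n) g) :=
        iSup_le fun j F hF => Submodule.mem_iSup_of_mem j (regRep_mem_piece (hφ j) g hF)
      exact hle
    -- By linearity of `f ↦ χ_θ ⊗ f` it is enough to take `f = φ j`, and `χ_θ ⊗ φ j` is the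
    -- generator `s = 0` of its piece.
    · rw [← h.span_eq_quasiPeriodic hr] at hf
      have hle : Submodule.span ℂ (Set.range φ) ≤
          (⨆ j, (pieceRep (hφ j)).toSubmodule).comap (tensMap θ) := by
        rw [Submodule.span_le]
        rintro _ ⟨j, rfl⟩
        refine Submodule.mem_iSup_of_mem j ?_
        change tens (chi θ) (φ j) ∈ piece θ (φ j)
        rw [← pieceGen_zero]
        exact pieceGen_mem (hφ j) 0
      exact hle hf
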